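/- All categories are small; $fg$ means first $f$, then $g$. A \emph{restriction category} is a category with an operation sending each $f\colon A\to B$ to $\bar f\colon A\to A$ such that $\bar f f=f$; $\bar f\bar g=\bar g\bar f$ and $\bar g\bar f=\overline{\bar g f}$ for $f,g$ with the same domain; and $f\bar g=\overline{fg}\,f$ for composable $f,g$. It is \emph{inverse} if for every $f\colon A\to B$ there is $f^\circ\colon B\to A$ with $ff^\circ=\bar f$ and $f^\circ f=\overline{f^\circ}$. A morphism $f$ is \emph{total} if $\bar f=\mathrm{id}$. A \emph{restriction functor} is a functor with $F\bar f=\overline{Ff}$. For restriction functors $F,G$, a \emph{restriction natural transformation} is a family of total morphisms $\varphi_A\colon FA\to GA$ with $(Ff)\varphi_B=(F\bar f)\varphi_A(Gf)$ for all $f\colon A\to B$, and a \emph{total natural transformation} is a natural transformation with total components. Let $\mathrm{invRCat}_{\mathrm{lax}}$ (respectively $\mathrm{invRCat}$) be the 2-category of inverse restriction categories, restriction functors, and restriction (respectively total) natural transformations. An \emph{inclusion system} on a category is a class $\mathscr N$ of monics, the \emph{inclusions}, that contains the identities, is closed under composition, contains at most one morphism between any two given objects, and is such that for every $m\colon A\to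 B$ in $\mathscr N$ and every $f\colon D\to B$ there is a pullback of $m$ along $f$ whose leg $P\to D$ lies in $\mathscr N$. It is \emph{bounded} if every object $A$ has exactly one maximal inclusion, that is, exactly one inclusion $\eta_A\colon A\to LA$ such that the existence of an inclusion $LA\to B$ forces $B=LA$. It is \emph{inverse} if every morphism is an isomorphism followed by an inclusion. It is \emph{cancellative} if $m\in\mathscr N$ whenever $n\in\mathscr N$ and $mn\in\mathscr N$. (For a bounded inclusion system this says that $\mathscr N$ consists of all $m\colon A\to B$ with $LA=LB$ and $m\eta_B=\eta_A$.) Let $\mathrm{invBNCat}_{\mathrm{lax}}$ be the 2-category of categories with a bounded, inverse and cancellative inclusion system; its 1-cells are the functors that preserve inclusions, pullbacks of inclusions along arbitrary morphisms, and maximal inclusions ($F\eta_A=\eta_{FA}$); its 2-cells are all natural transformations. Let $\mathrm{invBNCat}$ be the 2-category with the same objects and 1-cells, whose 2-cells are the natural transformations whose naturality squares at inclusions are pullbacks. Call an object of these 2-categories \emph{skeletal} if two inclusions $U\to A$ and $V\to A$ that are isomorphic over $A$ always have $U=V$. \textbf{Theorem.} There are 2-equivalences $$\mathrm{invRCat}_{\mathrm{lax}}\simeq\mathrm{invBNCat}_{\mathrm{lax}}\qquad\text{and}\qquad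 \mathrm{invRCat}\simeq\mathrm{invBNCat}.$$ Explicitly, in each of the two cases there are strict 2-functors $N$ from the left-hand to the right-hand 2-category and $R$ in the opposite direction, a strict 2-natural isomorphism $\mathrm{Id}\cong RN$, and a strict 2-natural transformation $\varepsilon\colon\mathrm{Id}\Rightarrow NR$ such that every component $\varepsilon_{\mathbb C}$ is an equivalence in the 2-category. Moreover, $N[\mathbb X]$ is skeletal for every $\mathbb X$, and $\varepsilon_{\mathbb C}$ is an isomorphism whenever $\mathbb C$ is skeletal; in particular $N$ and $R$ restrict to strict 2-equivalences with the full sub-2-categories of skeletal objects. -/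

import Mathlib

open CategoryTheory

universe u

/-! ### Restriction categories -/

/-- A restriction structure on a category (composition `f ≫ g` is first `f`, then `g`). -/
class RestrictionStructure (X : Type u) [Category.{u} X] where
  /-- The restriction idempotent of a morphism. -/
  rest : ∀ {A B : X}, (A ⟶ B) → (A ⟶ A)
  rest_comp_self : ∀ {A B : X} (f : A ⟶ B), rest f ≫ f = f
  rest_comm : ∀ {A B C : X} (f : A ⟶ B) (g : A ⟶ C), rest f ≫ rest g = rest g ≫ rest f
  rest_rest_comp : ∀ {A B C : X} (f : A ⟶ B) (g : A ⟶ C), rest g ≫ rest f = rest (rest g ≫ f)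
  comp_rest : ∀ {A B C : X} (f : A ⟶ B) (g : B ⟶ C), f ≫ rest g = rest (f ≫ g) ≫ f

namespace RestrictionStructure

variable {X : Type u} [Category.{u} X] [RestrictionStructure X]

/-- A morphism is total when its restriction idempotent is the identity. -/
def IsTotalMor {A B : X} (f : A ⟶ B) : Prop := rest f = 𝟙 A

/-- A restriction isomorphism (partial isomorphism). -/
def IsRestrictionIso {A B : X} (f : A ⟶ B) : Prop :=
  ∃ g : B ⟶ A, f ≫ g = rest f ∧ g ≫ f = rest g

theorem rest_id (A : X) : rest (𝟙 A) = 𝟙 A := by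
  simpa using rest_comp_self (𝟙 A)

theorem rest_comp_rest {A B C : X} (f : A ⟶ B) (g : B ⟶ C) :
    rest (f ≫ rest g) = rest (f ≫ g) := by
  rw [comp_rest, ← rest_rest_comp, rest_comm, rest_rest_comp, ← Category.assoc, rest_comp_self]

theorem isTotal_comp {A B C : X} {f : A ⟶ B} {g : B ⟶ C}
    (hf : IsTotalMor f) (hg : IsTotalMor g) :
    IsTotalMor (f ≫ g) := by
  unfold IsTotalMor at *
  rw [← rest_comp_rest, hg, Category.comp_id, hf]

end RestrictionStructure

open RestrictionStructure

/-- A (small) restriction category. -/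
structure RestrictionCategory : Type (u + 1) where
  /-- The objects. -/
  carrier : Type u
  [category : Category.{u} carrier]
  [restriction : RestrictionStructure carrier]

attribute [instance] RestrictionCategory.category RestrictionCategory.restriction

/-- An inverse restriction category: every morphism is a restriction isomorphism. -/
def RestrictionCategory.IsInverse (X : RestrictionCategory.{u}) : Prop :=
  ∀ ⦃A B : X.carrier⦄ (f : A ⟶ B), IsRestrictionIso f

/-- A restriction functor. -/
structure RestrictionFunctor (X Y : RestrictionCategory.{u}) extends X.carrier ⥤ Y.carrier where
  map_rest : ∀ {A B : X.carrier} (f : A ⟶ B), map (rest f) = rest (map f)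

namespace RestrictionFunctor

variable {X Y Z : RestrictionCategory.{u}}

/-- The identity restriction functor. -/
def id (X : RestrictionCategory.{u}) : RestrictionFunctor X X where
  toFunctor := 𝟭 X.carrier
  map_rest _ := rfl

/-- Composition of restriction functors, in diagrammatic order. -/
def comp (F : RestrictionFunctor X Y) (G : RestrictionFunctor Y Z) : RestrictionFunctor X Z where
  toFunctor := F.toFunctor ⋙ G.toFunctor
  map_rest f := by simp [F.map_rest, G.map_rest]

theorem map_total (F : RestrictionFunctor X Y) {A B : X.carrier} {f : A ⟶ B} (hf : IsTotalMor f) :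
    IsTotalMor (F.map f) := by
  unfold IsTotalMor at *
  rw [← F.map_rest, hf, F.map_id]

end RestrictionFunctor

/-- A restriction natural transformation. -/
@[ext]
structure RestrictionNatTrans {X Y : RestrictionCategory.{u}} (F G : RestrictionFunctor X Y) where
  /-- The components. -/
  app : ∀ A : X.carrier, F.obj A ⟶ G.obj A
  total : ∀ A, IsTotalMor (app A)
  naturality : ∀ {A B : X.carrier} (f : A ⟶ B),
    F.map f ≫ app B = F.map (rest f) ≫ app A ≫ G.map f

/-- A total natural transformation between restriction functors. -/
@[ext]
structure TotalRestrictionNatTrans {X Y : RestrictionCategory.{u}}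
    (F G : RestrictionFunctor X Y) where
  /-- The components. -/
  app : ∀ A : X.carrier, F.obj A ⟶ G.obj A
  total : ∀ A, IsTotalMor (app A)
  naturality : ∀ {A B : X.carrier} (f : A ⟶ B), F.map f ≫ app B = app A ≫ G.map f

namespace RestrictionNatTrans

variable {X Y Z : RestrictionCategory.{u}} {F G H : RestrictionFunctor X Y}

theorem naturality_of_total (φ : RestrictionNatTrans F G) {A B : X.carrier} {f : A ⟶ B}
    (hf : IsTotalMor f) : F.map f ≫ φ.app B = φ.app A ≫ G.map f := by
  rw [φ.naturality, show rest f = 𝟙 A from hf, F.map_id, Category.id_comp]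

theorem rest_app_rest (φ : RestrictionNatTrans F G) {A B : X.carrier} (f : A ⟶ B) :
    F.map (rest f) ≫ φ.app A ≫ G.map (rest f) = F.map (rest f) ≫ φ.app A := by
  have h := φ.naturality (rest f)
  have hr : rest (rest f) = rest f := by
    simpa [rest_id] using (rest_rest_comp (𝟙 A) f).symm
  rw [hr] at h
  exact h.symm

/-- The identity restriction natural transformation. -/
def id (F : RestrictionFunctor X Y) : RestrictionNatTrans F F where
  app _ := 𝟙 _
  total _ := rest_id _
  naturality f := by
    rw [Category.comp_id, Category.id_comp, ← F.map_comp, rest_comp_self]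

/-- Vertical composition. -/
def vcomp (φ : RestrictionNatTrans F G) (ψ : RestrictionNatTrans G H) :
    RestrictionNatTrans F H where
  app A := φ.app A ≫ ψ.app A
  total A := isTotal_comp (φ.total A) (ψ.total A)
  naturality {A B} f := by
    have h := φ.rest_app_rest f
    rw [← Category.assoc, φ.naturality, Category.assoc, Category.assoc, ψ.naturality]
    simp only [Category.assoc]
    simp only [← Category.assoc] at h ⊢
    rw [h]

/-- Whiskering with a restriction functor on the source side. -/
def whiskerLeft (K : RestrictionFunctor X Y) {F G : RestrictionFunctor Y Z}
    (φ : RestrictionNatTrans F G) : RestrictionNatTrans (K.comp F) (K.comp G) where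
  app A := φ.app (K.obj A)
  total A := φ.total (K.obj A)
  naturality f := by
    have h := φ.naturality (K.map f)
    rw [← K.map_rest] at h
    exact h

/-- Whiskering with a restriction functor on the target side. -/
def whiskerRight {F G : RestrictionFunctor X Y} (φ : RestrictionNatTrans F G)
    (K : RestrictionFunctor Y Z) : RestrictionNatTrans (F.comp K) (G.comp K) where
  app A := K.map (φ.app A)
  total A := K.map_total (φ.total A)
  naturality f := by
    have h := congrArg K.map (φ.naturality f)
    simp only [Functor.map_comp] at h
    exact h

end RestrictionNatTrans

namespace TotalRestrictionNatTrans

variable {X Y Z : RestrictionCategory.{u}} {F G H : RestrictionFunctor X Y}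

/-- The identity total natural transformation. -/
def id (F : RestrictionFunctor X Y) : TotalRestrictionNatTrans F F where
  app _ := 𝟙 _
  total _ := rest_id _
  naturality _ := (Category.comp_id _).trans (Category.id_comp _).symm

/-- Vertical composition. -/
def vcomp (φ : TotalRestrictionNatTrans F G) (ψ : TotalRestrictionNatTrans G H) :
    TotalRestrictionNatTrans F H where
  app A := φ.app A ≫ ψ.app A
  total A := isTotal_comp (φ.total A) (ψ.total A)
  naturality f := by
    rw [← Category.assoc, φ.naturality, Category.assoc, ψ.naturality, Category.assoc]

/-- Whiskering with a restriction functor on the source side. -/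
def whiskerLeft (K : RestrictionFunctor X Y) {F G : RestrictionFunctor Y Z}
    (φ : TotalRestrictionNatTrans F G) : TotalRestrictionNatTrans (K.comp F) (K.comp G) where
  app A := φ.app (K.obj A)
  total A := φ.total (K.obj A)
  naturality f := φ.naturality (K.map f)

/-- Whiskering with a restriction functor on the target side. -/
def whiskerRight {F G : RestrictionFunctor X Y} (φ : TotalRestrictionNatTrans F G)
    (K : RestrictionFunctor Y Z) : TotalRestrictionNatTrans (F.comp K) (G.comp K) where
  app A := K.map (φ.app A)
  total A := K.map_total (φ.total A)
  naturality f := by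
    have h := congrArg K.map (φ.naturality f)
    simp only [Functor.map_comp] at h
    exact h

end TotalRestrictionNatTrans

/-- The 2-category of restriction categories, restriction functors and restriction natural
transformations. -/
structure RCatLax : Type (u + 1) where
  /-- The underlying restriction category. -/
  cat : RestrictionCategory.{u}

/-- The 1-cells of `RCatLax`. -/
@[ext]
structure RCatLax.Hom (X Y : RCatLax.{u}) where
  /-- The underlying restriction functor. -/
  functor : RestrictionFunctor X.cat Y.cat

instance (X Y : RCatLax.{u}) : Category.{u} (RCatLax.Hom X Y) where
  Hom F G := RestrictionNatTrans F.functor G.functor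
  id F := RestrictionNatTrans.id F.functor
  comp φ ψ := RestrictionNatTrans.vcomp φ ψ
  id_comp _ := RestrictionNatTrans.ext (funext fun _ => Category.id_comp _)
  comp_id _ := RestrictionNatTrans.ext (funext fun _ => Category.comp_id _)
  assoc _ _ _ := RestrictionNatTrans.ext (funext fun _ => Category.assoc _ _ _)

instance : Bicategory.{u, u} RCatLax.{u} where
  Hom X Y := RCatLax.Hom X Y
  id X := ⟨RestrictionFunctor.id X.cat⟩
  comp F G := ⟨F.functor.comp G.functor⟩
  homCategory _ _ := inferInstance
  whiskerLeft F _ _ φ := RestrictionNatTrans.whiskerLeft F.functor φ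
  whiskerRight φ G := RestrictionNatTrans.whiskerRight φ G.functor
  associator F G H := Iso.refl (C := RCatLax.Hom _ _) ⟨(F.functor.comp G.functor).comp H.functor⟩
  leftUnitor F := Iso.refl (C := RCatLax.Hom _ _) F
  rightUnitor F := Iso.refl (C := RCatLax.Hom _ _) F
  whiskerLeft_id _ _ := rfl
  whiskerLeft_comp _ _ _ _ _ _ := rfl
  id_whiskerLeft _ := RestrictionNatTrans.ext (funext fun _ =>
    ((Category.id_comp _).trans (Category.comp_id _)).symm)
  comp_whiskerLeft _ _ _ _ _ := RestrictionNatTrans.ext (funext fun _ =>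
    ((Category.id_comp _).trans (Category.comp_id _)).symm)
  id_whiskerRight _ G := RestrictionNatTrans.ext (funext fun _ => G.functor.map_id _)
  comp_whiskerRight _ _ G := RestrictionNatTrans.ext (funext fun _ => G.functor.map_comp _ _)
  whiskerRight_id _ := RestrictionNatTrans.ext (funext fun _ =>
    ((Category.id_comp _).trans (Category.comp_id _)).symm)
  whiskerRight_comp _ _ _ := RestrictionNatTrans.ext (funext fun _ =>
    ((Category.id_comp _).trans (Category.comp_id _)).symm)
  whisker_assoc _ _ _ _ _ := RestrictionNatTrans.ext (funext fun _ =>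
    ((Category.id_comp _).trans (Category.comp_id _)).symm)
  whisker_exchange φ ψ := RestrictionNatTrans.ext (funext fun _ => (ψ.naturality_of_total (φ.total _)).symm)
  pentagon _ _ _ K := RestrictionNatTrans.ext (funext fun _ =>
    (congrArg (· ≫ 𝟙 _ ≫ 𝟙 _) (K.functor.map_id _)).trans (Category.id_comp _))
  triangle _ G := RestrictionNatTrans.ext (funext fun _ =>
    (Category.id_comp _).trans (G.functor.map_id _).symm)

instance : Bicategory.Strict RCatLax.{u} where
  id_comp _ := rfl
  comp_id _ := rfl
  assoc _ _ _ := rfl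
  leftUnitor_eqToIso _ := rfl
  rightUnitor_eqToIso _ := rfl
  associator_eqToIso _ _ _ := rfl

/-- The 2-category of restriction categories, restriction functors and total natural
transformations. -/
structure RCat : Type (u + 1) where
  /-- The underlying restriction category. -/
  cat : RestrictionCategory.{u}

/-- The 1-cells of `RCat`. -/
@[ext]
structure RCat.Hom (X Y : RCat.{u}) where
  /-- The underlying restriction functor. -/
  functor : RestrictionFunctor X.cat Y.cat

instance (X Y : RCat.{u}) : Category.{u} (RCat.Hom X Y) where
  Hom F G := TotalRestrictionNatTrans F.functor G.functor
  id F := TotalRestrictionNatTrans.id F.functor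
  comp φ ψ := TotalRestrictionNatTrans.vcomp φ ψ
  id_comp _ := TotalRestrictionNatTrans.ext (funext fun _ => Category.id_comp _)
  comp_id _ := TotalRestrictionNatTrans.ext (funext fun _ => Category.comp_id _)
  assoc _ _ _ := TotalRestrictionNatTrans.ext (funext fun _ => Category.assoc _ _ _)

instance : Bicategory.{u, u} RCat.{u} where
  Hom X Y := RCat.Hom X Y
  id X := ⟨RestrictionFunctor.id X.cat⟩
  comp F G := ⟨F.functor.comp G.functor⟩
  homCategory _ _ := inferInstance
  whiskerLeft F _ _ φ := TotalRestrictionNatTrans.whiskerLeft F.functor φ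
  whiskerRight φ G := TotalRestrictionNatTrans.whiskerRight φ G.functor
  associator F G H := Iso.refl (C := RCat.Hom _ _) ⟨(F.functor.comp G.functor).comp H.functor⟩
  leftUnitor F := Iso.refl (C := RCat.Hom _ _) F
  rightUnitor F := Iso.refl (C := RCat.Hom _ _) F
  whiskerLeft_id _ _ := rfl
  whiskerLeft_comp _ _ _ _ _ _ := rfl
  id_whiskerLeft _ := TotalRestrictionNatTrans.ext (funext fun _ =>
    ((Category.id_comp _).trans (Category.comp_id _)).symm)
  comp_whiskerLeft _ _ _ _ _ := TotalRestrictionNatTrans.ext (funext fun _ =>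
    ((Category.id_comp _).trans (Category.comp_id _)).symm)
  id_whiskerRight _ G := TotalRestrictionNatTrans.ext (funext fun _ => G.functor.map_id _)
  comp_whiskerRight _ _ G := TotalRestrictionNatTrans.ext (funext fun _ => G.functor.map_comp _ _)
  whiskerRight_id _ := TotalRestrictionNatTrans.ext (funext fun _ =>
    ((Category.id_comp _).trans (Category.comp_id _)).symm)
  whiskerRight_comp _ _ _ := TotalRestrictionNatTrans.ext (funext fun _ =>
    ((Category.id_comp _).trans (Category.comp_id _)).symm)
  whisker_assoc _ _ _ _ _ := TotalRestrictionNatTrans.ext (funext fun _ =>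
    ((Category.id_comp _).trans (Category.comp_id _)).symm)
  whisker_exchange _ ψ := TotalRestrictionNatTrans.ext (funext fun _ => (ψ.naturality _).symm)
  pentagon _ _ _ K := TotalRestrictionNatTrans.ext (funext fun _ =>
    (congrArg (· ≫ 𝟙 _ ≫ 𝟙 _) (K.functor.map_id _)).trans (Category.id_comp _))
  triangle _ G := TotalRestrictionNatTrans.ext (funext fun _ =>
    (Category.id_comp _).trans (G.functor.map_id _).symm)

instance : Bicategory.Strict RCat.{u} where
  id_comp _ := rfl
  comp_id _ := rfl
  assoc _ _ _ := rfl
  leftUnitor_eqToIso _ := rfl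
  rightUnitor_eqToIso _ := rfl
  associator_eqToIso _ _ _ := rfl

/-! ### Inclusion categories -/

/-- An inclusion system on a category. -/
class InclusionStructure (C : Type u) [Category.{u} C] where
  /-- The family of inclusions. -/
  incl : MorphismProperty C
  incl_id : ∀ A : C, incl (𝟙 A)
  incl_mono : ∀ {A B : C} (m : A ⟶ B), incl m → Mono m
  incl_unique : ∀ {A B : C} (m m' : A ⟶ B), incl m → incl m' → m = m'
  incl_comp : ∀ {A B D : C} (m : A ⟶ B) (m' : B ⟶ D), incl m → incl m' → incl (m ≫ m')
  incl_pullback : ∀ {A B D : C} (m : A ⟶ B) (f : D ⟶ B), incl m →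
    ∃ (P : C) (g : P ⟶ A) (m' : P ⟶ D), incl m' ∧ IsPullback g m' m f

namespace InclusionStructure

variable {C : Type u} [Category.{u} C] [InclusionStructure C]

/-- An inclusion with maximal codomain: no inclusion leads from `L` to another object. -/
def IsMaximalInclusion {A L : C} (m : A ⟶ L) : Prop :=
  incl m ∧ ∀ (B : C) (x : L ⟶ B), incl x → L = B

end InclusionStructure

open InclusionStructure

/-- A (small) bounded inclusion category: every object has exactly one maximal inclusion. -/
structure BoundedInclusionCategory : Type (u + 1) where
  /-- The objects. -/
  carrier : Type u
  [category : Category.{u} carrier]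
  [inclusion : InclusionStructure carrier]
  bounded : ∀ A : carrier, ∃! p : Σ L : carrier, (A ⟶ L), IsMaximalInclusion p.2

attribute [instance] BoundedInclusionCategory.category BoundedInclusionCategory.inclusion

namespace BoundedInclusionCategory

/-- Every morphism is an isomorphism followed by an inclusion. -/
def IsInverse (C : BoundedInclusionCategory.{u}) : Prop :=
  ∀ ⦃A B : C.carrier⦄ (f : A ⟶ B),
    ∃ (V : C.carrier) (g : A ⟶ V) (m : V ⟶ B), IsIso g ∧ incl m ∧ g ≫ m = f

/-- Inclusions are left cancellable: a morphism `m` into a subobject `n` is an inclusion as soon as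
its composite with `n` is one. -/
def IsCancellative (C : BoundedInclusionCategory.{u}) : Prop :=
  ∀ ⦃A B D : C.carrier⦄ (m : A ⟶ B) (n : B ⟶ D), incl n → incl (m ≫ n) → incl m

/-- Inclusions into the same object that are isomorphic over it have the same domain. -/
def IsSkeletal (C : BoundedInclusionCategory.{u}) : Prop :=
  ∀ ⦃U V A : C.carrier⦄ (m : U ⟶ A) (n : V ⟶ A), incl m → incl n →
    ∀ φ : U ≅ V, φ.hom ≫ n = m → U = V

end BoundedInclusionCategory

/-- An inclusion functor between bounded inclusion categories that preserves boundedness. -/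
structure BoundedInclusionFunctor (C D : BoundedInclusionCategory.{u}) extends
    C.carrier ⥤ D.carrier where
  map_incl : ∀ {A B : C.carrier} (m : A ⟶ B), incl m → incl (map m)
  map_pullback : ∀ {P A B V : C.carrier} (g : P ⟶ V) (p : P ⟶ A) (m : V ⟶ B) (f : A ⟶ B),
    incl m → IsPullback g p m f → IsPullback (map g) (map p) (map m) (map f)
  /-- The maximal inclusion of `A` is sent to the maximal inclusion of the image of `A`. -/
  map_maximal : ∀ {A L : C.carrier} (m : A ⟶ L), IsMaximalInclusion m → IsMaximalInclusion (map m)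

namespace BoundedInclusionFunctor

variable {C D E : BoundedInclusionCategory.{u}}

/-- The identity functor. -/
def id (C : BoundedInclusionCategory.{u}) : BoundedInclusionFunctor C C where
  toFunctor := 𝟭 C.carrier
  map_incl _ h := h
  map_pullback _ _ _ _ _ h := h
  map_maximal _ h := h

/-- Composition, in diagrammatic order. -/
def comp (F : BoundedInclusionFunctor C D) (G : BoundedInclusionFunctor D E) :
    BoundedInclusionFunctor C E where
  toFunctor := F.toFunctor ⋙ G.toFunctor
  map_incl _ h := G.map_incl _ (F.map_incl _ h)
  map_pullback _ _ _ _ hm h := G.map_pullback _ _ _ _ (F.map_incl _ hm) (F.map_pullback _ _ _ _ hm h)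
  map_maximal _ h := G.map_maximal _ (F.map_maximal _ h)

end BoundedInclusionFunctor

/-- An inclusion natural transformation: a natural transformation. -/
@[ext]
structure InclusionNatTrans {C D : BoundedInclusionCategory.{u}}
    (F G : BoundedInclusionFunctor C D) where
  /-- The components. -/
  app : ∀ A : C.carrier, F.obj A ⟶ G.obj A
  naturality : ∀ {A B : C.carrier} (f : A ⟶ B), F.map f ≫ app B = app A ≫ G.map f

/-- A total natural transformation: a natural transformation whose naturality squares at inclusions
are pullbacks. -/
@[ext]
structure TotalInclusionNatTrans {C D : BoundedInclusionCategory.{u}}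
    (F G : BoundedInclusionFunctor C D) where
  /-- The components. -/
  app : ∀ A : C.carrier, F.obj A ⟶ G.obj A
  naturality : ∀ {A B : C.carrier} (f : A ⟶ B), F.map f ≫ app B = app A ≫ G.map f
  isPullback : ∀ {U A : C.carrier} (m : U ⟶ A), incl m →
    IsPullback (app U) (F.map m) (G.map m) (app A)

namespace InclusionNatTrans

variable {C D E : BoundedInclusionCategory.{u}} {F G H : BoundedInclusionFunctor C D}

/-- The identity inclusion natural transformation. -/
def id (F : BoundedInclusionFunctor C D) : InclusionNatTrans F F where
  app _ := 𝟙 _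
  naturality _ := (Category.comp_id _).trans (Category.id_comp _).symm

/-- Vertical composition. -/
def vcomp (φ : InclusionNatTrans F G) (ψ : InclusionNatTrans G H) : InclusionNatTrans F H where
  app A := φ.app A ≫ ψ.app A
  naturality f := by
    rw [← Category.assoc, φ.naturality, Category.assoc, ψ.naturality, Category.assoc]

/-- Whiskering with a functor on the source side. -/
def whiskerLeft (K : BoundedInclusionFunctor C D) {F G : BoundedInclusionFunctor D E}
    (φ : InclusionNatTrans F G) : InclusionNatTrans (K.comp F) (K.comp G) where
  app A := φ.app (K.obj A)
  naturality f := φ.naturality (K.map f)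

/-- Whiskering with a functor on the target side. -/
def whiskerRight {F G : BoundedInclusionFunctor C D} (φ : InclusionNatTrans F G)
    (K : BoundedInclusionFunctor D E) : InclusionNatTrans (F.comp K) (G.comp K) where
  app A := K.map (φ.app A)
  naturality f := by
    have h := congrArg K.map (φ.naturality f)
    simp only [Functor.map_comp] at h
    exact h

end InclusionNatTrans

namespace TotalInclusionNatTrans

variable {C D E : BoundedInclusionCategory.{u}} {F G H : BoundedInclusionFunctor C D}

/-- The identity total natural transformation. -/
def id (F : BoundedInclusionFunctor C D) : TotalInclusionNatTrans F F where
  app _ := 𝟙 _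
  naturality _ := (Category.comp_id _).trans (Category.id_comp _).symm
  isPullback _ _ := IsPullback.of_horiz_isIso ⟨(Category.id_comp _).trans (Category.comp_id _).symm⟩

/-- Vertical composition. -/
def vcomp (φ : TotalInclusionNatTrans F G) (ψ : TotalInclusionNatTrans G H) : TotalInclusionNatTrans F H where
  app A := φ.app A ≫ ψ.app A
  naturality f := by
    rw [← Category.assoc, φ.naturality, Category.assoc, ψ.naturality, Category.assoc]
  isPullback m hm := (φ.isPullback m hm).paste_horiz (ψ.isPullback m hm)

/-- Whiskering with a functor on the source side. -/
def whiskerLeft (K : BoundedInclusionFunctor C D) {F G : BoundedInclusionFunctor D E}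
    (φ : TotalInclusionNatTrans F G) : TotalInclusionNatTrans (K.comp F) (K.comp G) where
  app A := φ.app (K.obj A)
  naturality f := φ.naturality (K.map f)
  isPullback m hm := φ.isPullback (K.map m) (K.map_incl m hm)

/-- Whiskering with a functor on the target side. -/
def whiskerRight {F G : BoundedInclusionFunctor C D} (φ : TotalInclusionNatTrans F G)
    (K : BoundedInclusionFunctor D E) : TotalInclusionNatTrans (F.comp K) (G.comp K) where
  app A := K.map (φ.app A)
  naturality f := by
    have h := congrArg K.map (φ.naturality f)
    simp only [Functor.map_comp] at h
    exact h
  isPullback m hm := K.map_pullback _ _ _ _ (G.map_incl m hm) (φ.isPullback m hm)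

end TotalInclusionNatTrans

/-- The 2-category of bounded inclusion categories, boundedness-preserving inclusion functors and
inclusion natural transformations. -/
structure BNCatLax : Type (u + 1) where
  /-- The underlying bounded inclusion category. -/
  cat : BoundedInclusionCategory.{u}

/-- The 1-cells of `BNCatLax`. -/
@[ext]
structure BNCatLax.Hom (X Y : BNCatLax.{u}) where
  /-- The underlying boundedness-preserving inclusion functor. -/
  functor : BoundedInclusionFunctor X.cat Y.cat

instance (X Y : BNCatLax.{u}) : Category.{u} (BNCatLax.Hom X Y) where
  Hom F G := InclusionNatTrans F.functor G.functor
  id F := InclusionNatTrans.id F.functor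
  comp φ ψ := InclusionNatTrans.vcomp φ ψ
  id_comp _ := InclusionNatTrans.ext (funext fun _ => Category.id_comp _)
  comp_id _ := InclusionNatTrans.ext (funext fun _ => Category.comp_id _)
  assoc _ _ _ := InclusionNatTrans.ext (funext fun _ => Category.assoc _ _ _)

instance : Bicategory.{u, u} BNCatLax.{u} where
  Hom X Y := BNCatLax.Hom X Y
  id X := ⟨BoundedInclusionFunctor.id X.cat⟩
  comp F G := ⟨F.functor.comp G.functor⟩
  homCategory _ _ := inferInstance
  whiskerLeft F _ _ φ := InclusionNatTrans.whiskerLeft F.functor φ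
  whiskerRight φ G := InclusionNatTrans.whiskerRight φ G.functor
  associator F G H := Iso.refl (C := BNCatLax.Hom _ _) ⟨(F.functor.comp G.functor).comp H.functor⟩
  leftUnitor F := Iso.refl (C := BNCatLax.Hom _ _) F
  rightUnitor F := Iso.refl (C := BNCatLax.Hom _ _) F
  whiskerLeft_id _ _ := rfl
  whiskerLeft_comp _ _ _ _ _ _ := rfl
  id_whiskerLeft _ := InclusionNatTrans.ext (funext fun _ =>
    ((Category.id_comp _).trans (Category.comp_id _)).symm)
  comp_whiskerLeft _ _ _ _ _ := InclusionNatTrans.ext (funext fun _ =>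
    ((Category.id_comp _).trans (Category.comp_id _)).symm)
  id_whiskerRight _ G := InclusionNatTrans.ext (funext fun _ => G.functor.map_id _)
  comp_whiskerRight _ _ G := InclusionNatTrans.ext (funext fun _ => G.functor.map_comp _ _)
  whiskerRight_id _ := InclusionNatTrans.ext (funext fun _ =>
    ((Category.id_comp _).trans (Category.comp_id _)).symm)
  whiskerRight_comp _ _ _ := InclusionNatTrans.ext (funext fun _ =>
    ((Category.id_comp _).trans (Category.comp_id _)).symm)
  whisker_assoc _ _ _ _ _ := InclusionNatTrans.ext (funext fun _ =>
    ((Category.id_comp _).trans (Category.comp_id _)).symm)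
  whisker_exchange _ ψ := InclusionNatTrans.ext (funext fun _ => (ψ.naturality _).symm)
  pentagon _ _ _ K := InclusionNatTrans.ext (funext fun _ =>
    (congrArg (· ≫ 𝟙 _ ≫ 𝟙 _) (K.functor.map_id _)).trans (Category.id_comp _))
  triangle _ G := InclusionNatTrans.ext (funext fun _ =>
    (Category.id_comp _).trans (G.functor.map_id _).symm)

instance : Bicategory.Strict BNCatLax.{u} where
  id_comp _ := rfl
  comp_id _ := rfl
  assoc _ _ _ := rfl
  leftUnitor_eqToIso _ := rfl
  rightUnitor_eqToIso _ := rfl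
  associator_eqToIso _ _ _ := rfl

/-- The 2-category of bounded inclusion categories, boundedness-preserving inclusion functors and
total natural transformations. -/
structure BNCat : Type (u + 1) where
  /-- The underlying bounded inclusion category. -/
  cat : BoundedInclusionCategory.{u}

/-- The 1-cells of `BNCat`. -/
@[ext]
structure BNCat.Hom (X Y : BNCat.{u}) where
  /-- The underlying boundedness-preserving inclusion functor. -/
  functor : BoundedInclusionFunctor X.cat Y.cat

instance (X Y : BNCat.{u}) : Category.{u} (BNCat.Hom X Y) where
  Hom F G := TotalInclusionNatTrans F.functor G.functor
  id F := TotalInclusionNatTrans.id F.functor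
  comp φ ψ := TotalInclusionNatTrans.vcomp φ ψ
  id_comp _ := TotalInclusionNatTrans.ext (funext fun _ => Category.id_comp _)
  comp_id _ := TotalInclusionNatTrans.ext (funext fun _ => Category.comp_id _)
  assoc _ _ _ := TotalInclusionNatTrans.ext (funext fun _ => Category.assoc _ _ _)

instance : Bicategory.{u, u} BNCat.{u} where
  Hom X Y := BNCat.Hom X Y
  id X := ⟨BoundedInclusionFunctor.id X.cat⟩
  comp F G := ⟨F.functor.comp G.functor⟩
  homCategory _ _ := inferInstance
  whiskerLeft F _ _ φ := TotalInclusionNatTrans.whiskerLeft F.functor φ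
  whiskerRight φ G := TotalInclusionNatTrans.whiskerRight φ G.functor
  associator F G H := Iso.refl (C := BNCat.Hom _ _) ⟨(F.functor.comp G.functor).comp H.functor⟩
  leftUnitor F := Iso.refl (C := BNCat.Hom _ _) F
  rightUnitor F := Iso.refl (C := BNCat.Hom _ _) F
  whiskerLeft_id _ _ := rfl
  whiskerLeft_comp _ _ _ _ _ _ := rfl
  id_whiskerLeft _ := TotalInclusionNatTrans.ext (funext fun _ =>
    ((Category.id_comp _).trans (Category.comp_id _)).symm)
  comp_whiskerLeft _ _ _ _ _ := TotalInclusionNatTrans.ext (funext fun _ =>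
    ((Category.id_comp _).trans (Category.comp_id _)).symm)
  id_whiskerRight _ G := TotalInclusionNatTrans.ext (funext fun _ => G.functor.map_id _)
  comp_whiskerRight _ _ G := TotalInclusionNatTrans.ext (funext fun _ => G.functor.map_comp _ _)
  whiskerRight_id _ := TotalInclusionNatTrans.ext (funext fun _ =>
    ((Category.id_comp _).trans (Category.comp_id _)).symm)
  whiskerRight_comp _ _ _ := TotalInclusionNatTrans.ext (funext fun _ =>
    ((Category.id_comp _).trans (Category.comp_id _)).symm)
  whisker_assoc _ _ _ _ _ := TotalInclusionNatTrans.ext (funext fun _ =>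
    ((Category.id_comp _).trans (Category.comp_id _)).symm)
  whisker_exchange _ ψ := TotalInclusionNatTrans.ext (funext fun _ => (ψ.naturality _).symm)
  pentagon _ _ _ K := TotalInclusionNatTrans.ext (funext fun _ =>
    (congrArg (· ≫ 𝟙 _ ≫ 𝟙 _) (K.functor.map_id _)).trans (Category.id_comp _))
  triangle _ G := TotalInclusionNatTrans.ext (funext fun _ =>
    (Category.id_comp _).trans (G.functor.map_id _).symm)

instance : Bicategory.Strict BNCat.{u} where
  id_comp _ := rfl
  comp_id _ := rfl
  assoc _ _ _ := rfl
  leftUnitor_eqToIso _ := rfl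
  rightUnitor_eqToIso _ := rfl
  associator_eqToIso _ _ _ := rfl

/-! ### The full 2-subcategories of inverse objects -/

/-- The full 2-subcategory of `RCatLax` spanned by the inverse restriction categories. -/
abbrev InvRCatLax : Type (u + 1) :=
  Bicategory.InducedBicategory RCatLax.{u}
    (fun X : { X : RestrictionCategory.{u} // X.IsInverse } => RCatLax.mk X.1)

/-- The full 2-subcategory of `RCat` spanned by the inverse restriction categories. -/
abbrev InvRCat : Type (u + 1) :=
  Bicategory.InducedBicategory RCat.{u}
    (fun X : { X : RestrictionCategory.{u} // X.IsInverse } => RCat.mk X.1)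

/-- The full 2-subcategory of `BNCatLax` spanned by the inverse inclusion categories (with left
cancellable inclusions). -/
abbrev InvBNCatLax : Type (u + 1) :=
  Bicategory.InducedBicategory BNCatLax.{u}
    (fun C : { C : BoundedInclusionCategory.{u} // C.IsInverse ∧ C.IsCancellative } =>
      BNCatLax.mk C.1)

/-- The full 2-subcategory of `BNCat` spanned by the inverse inclusion categories (with left
cancellable inclusions). -/
abbrev InvBNCat : Type (u + 1) :=
  Bicategory.InducedBicategory BNCat.{u}
    (fun C : { C : BoundedInclusionCategory.{u} // C.IsInverse ∧ C.IsCancellative } =>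
      BNCat.mk C.1)

/-! ### 2-equivalences -/

section TwoEquivalence

open Bicategory

universe w₁ w₂ v₁ v₂ u₁ u₂

variable {B : Type u₁} [Bicategory.{w₁, v₁} B] {C : Type u₂} [Bicategory.{w₂, v₂} C]

/-- A (strict) 2-natural transformation between (strict) 2-functors. -/
structure TwoNatTrans (F G : StrictPseudofunctor B C) where
  /-- The components. -/
  app : ∀ a : B, F.obj a ⟶ G.obj a
  naturality : ∀ {a b : B} (f : a ⟶ b), F.map f ≫ app b = app a ≫ G.map f
  naturality₂ : ∀ {a b : B} {f g : a ⟶ b} (α : f ⟶ g),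
    F.map₂ α ▷ app b ≫ eqToHom (naturality g) = eqToHom (naturality f) ≫ app a ◁ G.map₂ α

/-- A 1-cell with a strict inverse. -/
def IsIsoOneCell {a b : B} (f : a ⟶ b) : Prop :=
  ∃ g : b ⟶ a, f ≫ g = 𝟙 a ∧ g ≫ f = 𝟙 b

/-- A 1-cell with an inverse up to invertible 2-cells. -/
def IsEquivOneCell {a b : B} (f : a ⟶ b) : Prop :=
  ∃ g : b ⟶ a, Nonempty (f ≫ g ≅ 𝟙 a) ∧ Nonempty (g ≫ f ≅ 𝟙 b)

variable (B C)

/-- A 2-equivalence: 2-functors in both directions, and 2-natural transformations from the identities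
to the two composites all of whose components are equivalences. -/
structure TwoEquivalence where
  /-- The 2-functor. -/
  functor : StrictPseudofunctor B C
  /-- The 2-functor in the other direction. -/
  inverse : StrictPseudofunctor C B
  /-- The comparison on `B`. -/
  unit : TwoNatTrans (StrictPseudofunctor.id B) (functor.comp inverse)
  /-- The comparison on `C`. -/
  counit : TwoNatTrans (StrictPseudofunctor.id C) (inverse.comp functor)
  unit_isEquiv : ∀ b : B, IsEquivOneCell (unit.app b)
  counit_isEquiv : ∀ c : C, IsEquivOneCell (counit.app c)

end TwoEquivalence

/-! The 2-functor N sends a restriction category to `RestIdem X`: a pair (A, e) stands for the part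
of A on which the restriction idempotent e is defined, a morphism (A, e) → (B, e') is an f with
domain e and range inside e', and the inclusions are the inequalities e ≤ e' over one base. The
2-functor R sends an inclusion category to the partial morphisms between its maximal objects, that
is, spans with an inclusion as left leg, up to isomorphism. Partial inverses in X give the
factorization into an isomorphism and an inclusion in `RestIdem X`; conversely that factorization
lets a span be turned around.

The unit sends A to the identity idempotent on A. By `isMaximalInclusion_iff` the maximal objects of
`RestIdem X` are exactly these, and a span between two of them is the same thing as its right leg
(`toPartialMap_injective`, `toPartialMap_surjective`). Hence the unit is bijective on objects and
fully faithful, an isomorphism.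

The counit sends A to the idempotent span (η_A, η_A) on LA. It is fully faithful
(`ofMaximalMap_injective`, `ofMaximalMap_surjective`) and surjective on objects, because an
inclusion into a maximal object is the maximal inclusion of its domain. It identifies two objects
exactly when their maximal inclusions are isomorphic over a common codomain, which skeletality rules
out. A choice of preimages gives a quasi-inverse. For this to be a 1-cell the counit has to reflect
inclusions and maximal inclusions, and cancellativity provides that (`incl_of_incl_counit_map`,
`isMaximalInclusion_of_counit_map`).

On 2-cells, φ becomes F(e) φ_A at (A, e). Naturality up to restriction corresponds to plain
naturality, and strict naturality to the pullback condition at inclusions, so both equivalences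
share their action on objects and 1-cells. -/

namespace RestrictionStructure

variable {X : Type u} [Category.{u} X] [RestrictionStructure X]

theorem rest_rest {A B : X} (f : A ⟶ B) : rest (rest f) = rest f := by
  simpa [rest_id] using (rest_rest_comp (𝟙 A) f).symm

theorem rest_comp_rest_left {A B C : X} (f : A ⟶ B) (g : B ⟶ C) :
    rest (f ≫ g) ≫ rest f = rest (f ≫ g) := by
  rw [rest_comm, rest_rest_comp, ← Category.assoc, rest_comp_self]

theorem rest_comp_of_isTotal {A B C : X} (f : A ⟶ B) {g : B ⟶ C} (hg : IsTotalMor g) :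
    rest (f ≫ g) = rest f := by
  rw [← rest_comp_rest, hg, Category.comp_id]

end RestrictionStructure

/-! ### Restriction idempotents as a bounded inclusion category -/

/-- A restriction idempotent of a restriction category, as an object of its category of
restriction idempotents. -/
@[ext]
structure RestIdem (X : RestrictionCategory.{u}) where
  /-- The object on which the idempotent lives. -/
  base : X.carrier
  /-- The idempotent. -/
  e : base ⟶ base
  rest_e : rest e = e

namespace RestIdem

variable {X Y Z : RestrictionCategory.{u}}

attribute [simp] rest_e

@[simp]
theorem e_comp_e (P : RestIdem X) : P.e ≫ P.e = P.e := by
  simpa using rest_comp_self P.e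

/-- A morphism of restriction idempotents: a morphism with prescribed domain of definition and
range below the target. -/
@[ext]
structure Hom (P Q : RestIdem X) where
  /-- The underlying morphism. -/
  f : P.base ⟶ Q.base
  rest_f : rest f = P.e
  comp_e : f ≫ Q.e = f

instance : Category.{u} (RestIdem X) where
  Hom P Q := Hom P Q
  id P := ⟨P.e, P.rest_e, P.e_comp_e⟩
  comp {P Q R} f g := ⟨f.f ≫ g.f, by rw [← rest_comp_rest, g.rest_f, f.comp_e, f.rest_f], by
    rw [Category.assoc, g.comp_e]⟩
  id_comp {P Q} f := Hom.ext (by have := rest_comp_self f.f; rwa [f.rest_f] at this)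
  comp_id f := Hom.ext f.comp_e
  assoc f g h := Hom.ext (Category.assoc _ _ _)

theorem hom_ext {P Q : RestIdem X} {f g : P ⟶ Q} (h : f.f = g.f) : f = g := Hom.ext h

@[simp] theorem comp_f {P Q R : RestIdem X} (f : P ⟶ Q) (g : Q ⟶ R) :
    Hom.f (f ≫ g) = f.f ≫ g.f := rfl

@[simp] theorem e_comp_f {P Q : RestIdem X} (f : P ⟶ Q) : P.e ≫ f.f = f.f := by
  rw [← f.rest_f]; exact rest_comp_self f.f

/-- The inclusions between restriction idempotents: the inequalities between idempotents on the
same object. -/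
inductive IsIncl : ∀ ⦃P Q : RestIdem X⦄, (P ⟶ Q) → Prop
  | mk {A : X.carrier} {e e' : A ⟶ A} {h : rest e = e} {h' : rest e' = e'}
      (m : (⟨A, e, h⟩ : RestIdem X) ⟶ ⟨A, e', h'⟩) (hm : m.f = e) : IsIncl m

/-- The inverse image of e under f is the domain of f e. The vertex d and the legs are variables
tied down by equations, so that the lemma also covers images of such squares under a functor, where
the idempotent is F(rest (f e)), and naturality squares. -/
theorem isPullback_of_incl {A : X.carrier} {e e' : A ⟶ A} {h : rest e = e} {h' : rest e' = e'}
    (m : (⟨A, e, h⟩ : RestIdem X) ⟶ ⟨A, e', h'⟩) (hm : m.f = e) {D : RestIdem X}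
    (f : D ⟶ ⟨A, e', h'⟩)
    {d : D.base ⟶ D.base} {hd : rest d = d} (hde : d = rest (f.f ≫ e))
    (g : (⟨D.base, d, hd⟩ : RestIdem X) ⟶ ⟨A, e, h⟩) (hg : g.f = f.f ≫ e)
    (m' : (⟨D.base, d, hd⟩ : RestIdem X) ⟶ D) (hm' : m'.f = d) :
    IsPullback g m' m f := by
  have he : e ≫ e = e := by simpa [h] using rest_comp_self e
  have hee : e ≫ e' = e := by
    have := m.comp_e
    rwa [hm] at this
  have hc : rest (f.f ≫ e) ≫ f.f = f.f ≫ e := by rw [← comp_rest, h]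
  refine IsPullback.mk' (hom_ext ?_) ?_ ?_
  · simp [hg, hm, hm', hde, he, hc]
  · intro T φ ψ _ h2
    have := congrArg Hom.f h2
    simp only [comp_f, hm'] at this
    have h1 := φ.comp_e
    have h3 := ψ.comp_e
    simp only at h1 h3
    exact hom_ext (by rw [← h1, ← h3, this])
  · intro T a b hab
    have hab' := congrArg Hom.f hab
    simp only [comp_f, hm] at hab'
    have ha : a.f ≫ e = a.f := a.comp_e
    -- The leg b lies inside d: b d = rest (b f e) b, while b f e = a e = a has the same domain as
    -- b.
    have hbd : b.f ≫ d = b.f := by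
      rw [hde, comp_rest, ← Category.assoc, ← hab', ha, ha, a.rest_f, e_comp_f]
    refine ⟨⟨b.f, b.rest_f, hbd⟩, hom_ext ?_, hom_ext ?_⟩
    · change b.f ≫ g.f = _
      rw [hg, ← Category.assoc, ← hab', ha, ha]
    · change b.f ≫ m'.f = _
      rw [hm', hbd]

instance : InclusionStructure (RestIdem X) where
  incl := IsIncl
  incl_id P := ⟨_, rfl⟩
  incl_mono {P Q} m hm := by
    obtain ⟨m, hm⟩ := hm
    refine ⟨fun {T} a b hab => hom_ext ?_⟩
    have := congrArg Hom.f hab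
    simp only [comp_f, hm] at this
    have ha := a.comp_e
    have hb := b.comp_e
    simp only at ha hb
    rw [← ha, ← hb, this]
  incl_unique {P Q} m m' hm hm' := by
    obtain ⟨m, hm⟩ := hm
    cases hm' with
    | mk _ hm' => exact hom_ext (hm.trans hm'.symm)
  incl_comp {P Q R} m m' hm hm' := by
    obtain ⟨m, hm⟩ := hm
    cases hm' with
    | mk _ hm' =>
      refine ⟨_, ?_⟩
      rw [comp_f, hm, hm']
      have := m.comp_e
      rwa [hm] at this
  incl_pullback {P Q D} m f hm := by
    obtain @⟨A, e, e', h, h', m, hm⟩ := hm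
    have he : e ≫ e = e := by simpa [h] using rest_comp_self e
    refine ⟨⟨D.base, rest (f.f ≫ e), rest_rest _⟩, ⟨f.f ≫ e, rfl, by simp [he]⟩,
      ⟨rest (f.f ≫ e), rest_rest _, ?_⟩, ?_,
      isPullback_of_incl m hm f rfl _ rfl _ rfl⟩
    · rw [← f.rest_f, rest_comp_rest_left]
    · obtain ⟨D, d, hd⟩ := D
      exact ⟨_, rfl⟩

/-- Inclusions never change the base, and over a fixed base the identity is the largest restriction
idempotent: every e lies below it, and nothing else lies above it. -/
theorem isMaximalInclusion_iff {P Q : RestIdem X} (m : P ⟶ Q) :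
    IsMaximalInclusion m ↔ incl m ∧ Q.e = 𝟙 _ := by
  constructor
  · rintro ⟨hm, h⟩
    refine ⟨hm, ?_⟩
    obtain ⟨A, e, he⟩ := Q
    have := h ⟨A, 𝟙 A, rest_id A⟩ ⟨e, he, Category.comp_id _⟩ ⟨_, rfl⟩
    simpa using this
  · rintro ⟨hm, h⟩
    refine ⟨hm, fun B x hx => ?_⟩
    cases hx with
    | @mk A e e' h1 h2 x hx =>
      simp only at h
      subst h
      have := x.comp_e
      rw [hx] at this
      have : e' = 𝟙 A := (Category.id_comp e').symm.trans this
      subst this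
      rfl

/-- The maximal inclusion of a restriction idempotent. -/
def toTop (P : RestIdem X) : P ⟶ ⟨P.base, 𝟙 _, rest_id _⟩ :=
  ⟨P.e, P.rest_e, Category.comp_id _⟩

theorem toTop_isMaximal (P : RestIdem X) : IsMaximalInclusion P.toTop :=
  (isMaximalInclusion_iff _).2 ⟨⟨_, rfl⟩, rfl⟩

variable (X) in
/-- The bounded inclusion category of restriction idempotents. -/
abbrev boundedInclusionCategory : BoundedInclusionCategory.{u} where
  carrier := RestIdem X
  bounded P := by
    refine ⟨⟨_, P.toTop⟩, P.toTop_isMaximal, ?_⟩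
    rintro ⟨Q, m⟩ hm
    obtain ⟨hm, hQ⟩ := (isMaximalInclusion_iff m).1 hm
    clear * - hm hQ
    obtain ⟨m, hm⟩ := hm
    simp only at hQ
    subst hQ
    congr 1
    exact hom_ext hm

/-- The image of f is the domain of its partial inverse g: f and g become mutually inverse between P
and the idempotent rest g = g f, which lies below Q. -/
theorem isInverse (hX : X.IsInverse) : (boundedInclusionCategory X).IsInverse := by
  intro P Q f
  obtain ⟨g, hfg, hgf⟩ := hX f.f
  have hg : rest g ≫ Q.e = rest g := by rw [← hgf, Category.assoc, f.comp_e]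
  let V : RestIdem X := ⟨Q.base, rest g, rest_rest g⟩
  let φ : P ⟶ V := ⟨f.f, f.rest_f, by
    change f.f ≫ rest g = f.f
    rw [← hgf, ← Category.assoc, hfg, rest_comp_self]⟩
  let ψ : V ⟶ P := ⟨g, rfl, by rw [← f.rest_f, ← hfg, ← Category.assoc, hgf, rest_comp_self]⟩
  refine ⟨V, φ, ⟨rest g, rest_rest g, hg⟩, ?_, ?_, ?_⟩
  · exact ⟨ψ, hom_ext (hfg.trans f.rest_f), hom_ext hgf⟩
  · exact ⟨_, rfl⟩
  · exact hom_ext φ.comp_e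

/-- Composing with an inclusion n multiplies by the idempotent of the middle object, which m already
absorbs. Thus m and its composite with n have the same underlying morphism. -/
theorem isCancellative : (boundedInclusionCategory X).IsCancellative := by
  intro P Q R m n hn hmn
  obtain ⟨n, hn⟩ := hn
  have hm : m.f ≫ n.f = m.f := by rw [hn]; exact m.comp_e
  generalize hk : m ≫ n = k at hmn
  cases hmn with
  | mk k hk' => exact ⟨_, hm.symm.trans ((congrArg Hom.f hk).trans hk')⟩

/-- An isomorphism over A must have e₁ as underlying morphism and e as that of its inverse. This
gives e₁ ≤ e ≤ e₁, and restriction idempotents commute. -/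
theorem isSkeletal : (boundedInclusionCategory X).IsSkeletal := by
  intro U V A m n hm hn φ hφ
  obtain @⟨A, e₁, e', k, h', m, hm⟩ := hm
  cases hn with
  | @mk A e e' h h' n hn =>
    have h1 : φ.hom.f ≫ n.f = m.f := congrArg Hom.f hφ
    have h2 : φ.inv.f ≫ m.f = n.f := congrArg Hom.f ((Iso.inv_comp_eq φ).2 hφ.symm)
    have h3 := φ.hom.comp_e
    have h4 := φ.inv.comp_e
    simp only at h3 h4
    rw [hm, hn] at h1 h2
    rw [h3] at h1
    rw [h4] at h2
    have h5 : e₁ ≫ e = e₁ := (congrArg (· ≫ e) h1).symm.trans (h3.trans h1)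
    have h6 : e ≫ e₁ = e := (congrArg (· ≫ e₁) h2).symm.trans (h4.trans h2)
    have h7 := rest_comm e₁ e
    have h8 : e₁ = e := h5.symm.trans ((by rwa [k, h] at h7 : e₁ ≫ e = e ≫ e₁).trans h6)
    subst h8
    rfl

/-- Pullbacks of a cospan are unique up to isomorphism, so preservation need only be checked on one
of them; for `RestIdem` this is the explicit one of `isPullback_of_incl`. -/
theorem _root_.CategoryTheory.Functor.map_isPullback_of_isPullback {C D : Type*} [Category C]
    [Category D] (F : C ⥤ D) {P P' A B V : C} {g : P ⟶ V} {p : P ⟶ A} {g' : P' ⟶ V} {p' : P' ⟶ A}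
    {m : V ⟶ B} {f : A ⟶ B} (h : IsPullback g p m f) (h' : IsPullback g' p' m f)
    (hF : IsPullback (F.map g') (F.map p') (F.map m) (F.map f)) :
    IsPullback (F.map g) (F.map p) (F.map m) (F.map f) :=
  hF.of_iso (F.mapIso (h'.isoIsPullback V A h)) (Iso.refl (F.obj V)) (Iso.refl (F.obj A))
    (Iso.refl (F.obj B)) (by simp [← Functor.map_comp]) (by simp [← Functor.map_comp]) (by simp)
    (by simp)

/-- The functor on restriction idempotents induced by a restriction functor. -/
@[simps]
def mapFunctor (F : RestrictionFunctor X Y) : RestIdem X ⥤ RestIdem Y where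
  obj P := ⟨F.obj P.base, F.map P.e, by rw [← F.map_rest, P.rest_e]⟩
  map f := ⟨F.map f.f, (F.map_rest _).symm.trans (congrArg F.map f.rest_f), by
    rw [← F.map_comp, f.comp_e]⟩
  map_id _ := rfl
  map_comp _ _ := hom_ext (F.map_comp _ _)

/-- The action on restriction idempotents of a restriction functor. -/
def map (F : RestrictionFunctor X Y) :
    BoundedInclusionFunctor (boundedInclusionCategory X) (boundedInclusionCategory Y) where
  toFunctor := mapFunctor F
  map_incl m hm := by
    obtain ⟨m, hm⟩ := hm
    exact ⟨_, congrArg F.map hm⟩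
  map_pullback {P D B V} g p m f hm h := by
    obtain @⟨A, e, e', h₁, h₂, m, hm⟩ := hm
    have he : e ≫ e = e := by simpa [h₁] using rest_comp_self e
    let g' : (⟨D.base, rest (f.f ≫ e), rest_rest _⟩ : RestIdem X) ⟶ ⟨A, e, h₁⟩ :=
      ⟨f.f ≫ e, rfl, by simp [he]⟩
    let p' : (⟨D.base, rest (f.f ≫ e), rest_rest _⟩ : RestIdem X) ⟶ D :=
      ⟨rest (f.f ≫ e), rest_rest _, by rw [← f.rest_f, rest_comp_rest_left]⟩
    refine (mapFunctor F).map_isPullback_of_isPullback h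
      (isPullback_of_incl m hm f rfl g' rfl p' rfl) ?_
    exact isPullback_of_incl _ (congrArg F.map hm) _ ((F.map_rest _).trans
      (congrArg rest (F.map_comp _ _))) _ (F.map_comp _ _) _ rfl
  map_maximal m hm := by
    rw [isMaximalInclusion_iff] at hm ⊢
    obtain ⟨⟨m, hm⟩, h⟩ := hm
    exact ⟨⟨_, congrArg F.map hm⟩, (congrArg F.map h).trans (F.map_id _)⟩

/-- The action on restriction idempotents of a restriction natural transformation. -/
def mapNat {F G : RestrictionFunctor X Y} (φ : RestrictionNatTrans F G) :
    InclusionNatTrans (map F) (map G) where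
  app P := ⟨F.map P.e ≫ φ.app P.base,
    (rest_comp_of_isTotal _ (φ.total _)).trans
      ((F.map_rest _).symm.trans (congrArg F.map P.rest_e)), by
      -- Naturality up to restriction, applied to e itself, says that F(e) φ_A lands in G(e).
      have := φ.rest_app_rest P.e
      rw [P.rest_e, ← Category.assoc] at this
      exact this⟩
  naturality {P Q} f := hom_ext <| by
    change F.map f.f ≫ F.map Q.e ≫ φ.app Q.base = (F.map P.e ≫ φ.app P.base) ≫ G.map f.f
    rw [← Category.assoc, ← F.map_comp, f.comp_e, φ.naturality, f.rest_f, Category.assoc]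

/-- The action on restriction idempotents of a total natural transformation. -/
def mapTotalNat {F G : RestrictionFunctor X Y} (φ : TotalRestrictionNatTrans F G) :
    TotalInclusionNatTrans (map F) (map G) where
  app P := ⟨F.map P.e ≫ φ.app P.base,
    (rest_comp_of_isTotal _ (φ.total _)).trans
      ((F.map_rest _).symm.trans (congrArg F.map P.rest_e)), by
      change (F.map P.e ≫ φ.app P.base) ≫ G.map P.e = _
      rw [Category.assoc, ← φ.naturality, ← Category.assoc, ← F.map_comp, P.e_comp_e]
      rfl⟩
  naturality {P Q} f := hom_ext <| by
    change F.map f.f ≫ F.map Q.e ≫ φ.app Q.base = (F.map P.e ≫ φ.app P.base) ≫ G.map f.f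
    rw [← Category.assoc, ← F.map_comp, f.comp_e, Category.assoc, ← φ.naturality, ← Category.assoc,
      ← F.map_comp, e_comp_f]
  isPullback m hm := by
    obtain @⟨A, e, e', h₁, h₂, m, hm⟩ := hm
    have hee : e' ≫ e = e := by
      have := m.comp_e
      rw [hm] at this
      simp only at this
      have h := rest_comm e e'
      rw [h₁, h₂, this] at h
      exact h.symm
    -- Strict naturality is essential here: the lax condition yields only F(e) φ_A ≤ φ_A G(e). With
    -- equality, the inverse image of G(e) is exactly F(e), because φ_A is total.
    have he : (F.map e' ≫ φ.app A) ≫ G.map e = F.map e ≫ φ.app A := by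
      rw [Category.assoc, ← φ.naturality, ← Category.assoc, ← F.map_comp, hee]
    refine isPullback_of_incl _ (congrArg G.map hm) _ ?_ _ he.symm _ (congrArg F.map hm)
    refine Eq.trans ?_ (congrArg rest he.symm)
    exact ((rest_comp_of_isTotal _ (φ.total _)).trans
      ((F.map_rest _).symm.trans (congrArg F.map h₁))).symm

end RestIdem

/-! ### Partial morphisms and their restriction structure -/

/-- A span whose left leg is an inclusion. -/
structure PartialSpan {C : Type u} [Category.{u} C] [InclusionStructure C] (A B : C) where
  /-- The domain of definition. -/
  dom : C
  /-- The inclusion of the domain of definition. -/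
  inc : dom ⟶ A
  incl_inc : incl inc
  /-- The underlying morphism. -/
  map : dom ⟶ B

/-- Isomorphism of spans. -/
instance PartialSpan.setoid {C : Type u} [Category.{u} C] [InclusionStructure C] (A B : C) :
    Setoid (PartialSpan A B) where
  r s t := ∃ φ : s.dom ≅ t.dom, φ.hom ≫ t.inc = s.inc ∧ φ.hom ≫ t.map = s.map
  iseqv :=
    { refl := fun s => ⟨Iso.refl _, Category.id_comp _, Category.id_comp _⟩
      symm := fun ⟨φ, h₁, h₂⟩ =>
        ⟨φ.symm, (Iso.inv_comp_eq φ).2 h₁.symm, (Iso.inv_comp_eq φ).2 h₂.symm⟩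
      trans := fun ⟨φ, h₁, h₂⟩ ⟨ψ, h₃, h₄⟩ => ⟨φ ≪≫ ψ, by simp [h₁, h₃], by simp [h₂, h₄]⟩ }

/-- A partial morphism: an isomorphism class of spans whose left leg is an inclusion. -/
def PartialMap {C : Type u} [Category.{u} C] [InclusionStructure C] (A B : C) : Type u :=
  Quotient (PartialSpan.setoid A B)

namespace PartialMap

variable {C : Type u} [Category.{u} C] [InclusionStructure C]

/-- The partial morphism represented by a span. -/
def mk {A B U : C} (m : U ⟶ A) (hm : incl m) (f : U ⟶ B) : PartialMap A B :=
  Quotient.mk _ ⟨U, m, hm, f⟩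

@[elab_as_elim]
theorem ind {A B : C} {p : PartialMap A B → Prop}
    (h : ∀ (U : C) (m : U ⟶ A) (hm : incl m) (f : U ⟶ B), p (mk m hm f)) (x : PartialMap A B) :
    p x :=
  Quotient.ind (fun s => h s.dom s.inc s.incl_inc s.map) x

theorem mk_eq_mk_iff {A B U V : C} {m : U ⟶ A} {hm : incl m} {f : U ⟶ B} {n : V ⟶ A}
    {hn : incl n} {g : V ⟶ B} :
    mk m hm f = mk n hn g ↔ ∃ φ : U ≅ V, φ.hom ≫ n = m ∧ φ.hom ≫ g = f :=
  Quotient.eq (r := PartialSpan.setoid A B)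

theorem mk_eq_mk {A B U V : C} {m : U ⟶ A} {hm : incl m} {f : U ⟶ B} {n : V ⟶ A}
    {hn : incl n} {g : V ⟶ B} (φ : U ≅ V) (h₁ : φ.hom ≫ n = m) (h₂ : φ.hom ≫ g = f) :
    mk m hm f = mk n hn g :=
  mk_eq_mk_iff.2 ⟨φ, h₁, h₂⟩

theorem mk_congr {A B U : C} {m m' : U ⟶ A} {hm : incl m} {hm' : incl m'} {f f' : U ⟶ B}
    (h : m = m') (h' : f = f') : mk m hm f = mk m' hm' f' := by
  subst h h'; rfl

/-- Independence of the representatives and of the pullback at once: isomorphisms of spans carry one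
pullback to another pullback of the same cospan. It makes composition well defined and frees it from
the choice of pullback. -/
theorem mk_comp_eq {A B D U V P U' V' P' : C}
    {m : U ⟶ A} {f : U ⟶ B} {n : V ⟶ B} {g : V ⟶ D} {p : P ⟶ V} {q : P ⟶ U}
    {m' : U' ⟶ A} {f' : U' ⟶ B} {n' : V' ⟶ B} {g' : V' ⟶ D} {p' : P' ⟶ V'} {q' : P' ⟶ U'}
    (φ : U ≅ U') (h₁ : φ.hom ≫ m' = m) (h₂ : φ.hom ≫ f' = f)
    (ψ : V ≅ V') (h₃ : ψ.hom ≫ n' = n) (h₄ : ψ.hom ≫ g' = g)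
    (h : IsPullback p q n f) (h' : IsPullback p' q' n' f')
    (hq : incl (q ≫ m)) (hq' : incl (q' ≫ m')) :
    mk (q ≫ m) hq (p ≫ g) = mk (q' ≫ m') hq' (p' ≫ g') := by
  have h'' : IsPullback (p ≫ ψ.hom) (q ≫ φ.hom) n' f' :=
    h.of_iso (Iso.refl _) ψ φ (Iso.refl _) (by simp) (by simp) (by simp [h₃]) (by simp [h₂])
  refine mk_eq_mk (h''.isoIsPullback _ _ h') ?_ ?_
  · rw [← Category.assoc, IsPullback.isoIsPullback_hom_snd, Category.assoc, h₁]
  · rw [← Category.assoc, IsPullback.isoIsPullback_hom_fst, Category.assoc, h₄]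

/-- A composite of spans. -/
noncomputable def _root_.PartialSpan.comp {A B D : C} (s : PartialSpan A B) (t : PartialSpan B D) :
    PartialSpan A D :=
  have h := incl_pullback t.inc s.map t.incl_inc
  ⟨h.choose, h.choose_spec.choose_spec.choose ≫ s.inc,
    incl_comp _ _ h.choose_spec.choose_spec.choose_spec.1 s.incl_inc,
    h.choose_spec.choose ≫ t.map⟩

/-- Composition of partial morphisms. -/
noncomputable def comp {A B D : C} (x : PartialMap A B) (y : PartialMap B D) : PartialMap A D :=
  Quotient.map₂ PartialSpan.comp (by
    rintro s s' ⟨φ, h₁, h₂⟩ t t' ⟨ψ, h₃, h₄⟩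
    have h := (incl_pullback t.inc s.map t.incl_inc).choose_spec.choose_spec.choose_spec.2
    have h' := (incl_pullback t'.inc s'.map t'.incl_inc).choose_spec.choose_spec.choose_spec.2
    exact mk_eq_mk_iff.1 (mk_comp_eq φ h₁ h₂ ψ h₃ h₄ h h' (s.comp t).incl_inc
      (s'.comp t').incl_inc)) x y

/-- Composition is defined by a chosen pullback. Here any pullback with an inclusion leg may replace
it, such as the image of one under a functor or a naturality square. -/
theorem mk_comp_mk {A B D U V P : C} {m : U ⟶ A} {hm : incl m} {f : U ⟶ B} {n : V ⟶ B}
    {hn : incl n} {g : V ⟶ D} {p : P ⟶ V} {q : P ⟶ U} (hq : incl q) (h : IsPullback p q n f) :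
    (mk m hm f).comp (mk n hn g) = mk (q ≫ m) (incl_comp _ _ hq hm) (p ≫ g) :=
  mk_comp_eq (Iso.refl U) (Category.id_comp _) (Category.id_comp _) (Iso.refl V)
    (Category.id_comp _) (Category.id_comp _)
    (incl_pullback n f hn).choose_spec.choose_spec.choose_spec.2 h
    (PartialSpan.comp ⟨U, m, hm, f⟩ ⟨V, n, hn, g⟩).incl_inc _

/-- Composition when the range of the first factor lies in the domain of the second. -/
theorem mk_comp_mk_of_factor {A B D U V : C} {m : U ⟶ A} {hm : incl m} {f : U ⟶ B} {n : V ⟶ B}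
    {hn : incl n} {g : V ⟶ D} (k : U ⟶ V) (hk : k ≫ n = f) :
    (mk m hm f).comp (mk n hn g) = mk m hm (k ≫ g) := by
  have := incl_mono n hn
  -- Since n is monic, a factorization of f through n is already a pullback square.
  have h : IsPullback k (𝟙 U) n f := IsPullback.of_vert_isIso_mono ⟨by simp [hk]⟩
  rw [mk_comp_mk (incl_id U) h]
  exact mk_congr (Category.id_comp _) rfl

variable (C) in
/-- The objects without proper inclusions into other objects. -/
structure MaxObj where
  /-- The underlying object. -/
  obj : C
  isMax : IsMaximalInclusion (𝟙 obj)

noncomputable instance : Category.{u} (MaxObj C) where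
  Hom A B := PartialMap A.obj B.obj
  id A := mk (𝟙 A.obj) (incl_id _) (𝟙 A.obj)
  comp x y := x.comp y
  id_comp {A B} x := by
    induction x using ind with
    | h U m hm f =>
      rw [mk_comp_mk hm (IsPullback.of_id_fst)]
      exact mk_congr (Category.comp_id _) (Category.id_comp _)
  comp_id {A B} x := by
    induction x using ind with
    | h U m hm f =>
      rw [mk_comp_mk_of_factor f (Category.comp_id _)]
      exact mk_congr rfl (Category.comp_id _)
  assoc {A B D E} x y z := by
    induction x using ind with
    | h U m hm f =>
    induction y using ind with
    | h V n hn g =>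
    induction z using ind with
    | h W k hk l =>
      obtain ⟨P, p, q, hq, hP⟩ := incl_pullback n f hn
      obtain ⟨Q, r, s, hs, hQ⟩ := incl_pullback k g hk
      -- Pasting T with Q computes one bracketing and pasting T with P the other, so both are
      -- represented by spans out of T.
      obtain ⟨T, t, w, hw, hT⟩ := incl_pullback s p hs
      rw [mk_comp_mk hq hP, mk_comp_mk hs hQ, mk_comp_mk hw (hT.flip.paste_vert hQ.flip).flip,
        mk_comp_mk (incl_comp _ _ hw hq) (hT.paste_vert hP)]
      exact mk_congr (Category.assoc _ _ _).symm (Category.assoc _ _ _)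

theorem comp_def {A B D : MaxObj C} (x : A ⟶ B) (y : B ⟶ D) : x ≫ y = x.comp y := rfl

/-- The restriction idempotent of a partial morphism. -/
def dom {A B : C} (x : PartialMap A B) : PartialMap A A :=
  Quotient.map (fun s => ⟨s.dom, s.inc, s.incl_inc, s.inc⟩)
    (by rintro s t ⟨φ, h₁, -⟩; exact ⟨φ, h₁, h₁⟩) x

@[simp]
theorem dom_mk {A B U : C} (m : U ⟶ A) (hm : incl m) (f : U ⟶ B) :
    (mk m hm f).dom = mk m hm m := rfl

noncomputable instance : RestrictionStructure (MaxObj C) where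
  rest x := x.dom
  rest_comp_self {A B} x := by
    induction x using ind with
    | h U m hm f =>
      rw [comp_def, dom_mk, mk_comp_mk_of_factor (𝟙 U) (Category.id_comp _)]
      exact mk_congr rfl (Category.id_comp _)
  rest_comm {A B D} x y := by
    induction x using ind with
    | h U m hm f =>
    induction y using ind with
    | h V n hn g =>
      obtain ⟨P, p, q, hq, hP⟩ := incl_pullback n m hn
      obtain ⟨Q, p', q', hq', hQ⟩ := incl_pullback m n hm
      simp only [comp_def, dom_mk]
      rw [mk_comp_mk hq hP, mk_comp_mk hq' hQ]
      refine mk_eq_mk (hP.flip.isoIsPullback _ _ hQ) ?_ ?_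
      · rw [← Category.assoc, IsPullback.isoIsPullback_hom_snd, hP.w]
      · rw [← Category.assoc, IsPullback.isoIsPullback_hom_fst, hP.w]
  rest_rest_comp {A B D} x y := by
    induction x using ind with
    | h U m hm f =>
    induction y using ind with
    | h V n hn g =>
      obtain ⟨P, p, q, hq, hP⟩ := incl_pullback m n hm
      simp only [comp_def, dom_mk]
      rw [mk_comp_mk hq hP, mk_comp_mk hq hP, dom_mk]
      exact mk_congr rfl hP.w
  comp_rest {A B D} x y := by
    induction x using ind with
    | h U m hm f =>
    induction y using ind with
    | h V n hn g =>
      obtain ⟨P, p, q, hq, hP⟩ := incl_pullback n f hn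
      simp only [comp_def, dom_mk]
      rw [mk_comp_mk hq hP, mk_comp_mk hq hP, dom_mk, mk_comp_mk_of_factor q rfl]
      exact mk_congr rfl hP.w

theorem rest_def {A B : MaxObj C} (x : A ⟶ B) : rest x = x.dom := rfl

end PartialMap

open PartialMap

namespace BoundedInclusionCategory

variable {C D E : BoundedInclusionCategory.{u}}

variable (C) in
/-- The restriction category of partial morphisms between maximal objects. -/
noncomputable abbrev partialMaps : RestrictionCategory.{u} where
  carrier := MaxObj C.carrier

/-- Once the right leg is g followed by an inclusion n with g invertible, the span can be read
backwards, with n as its left leg. -/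
theorem partialMaps_isInverse (hC : C.IsInverse) : C.partialMaps.IsInverse := by
  intro A B x
  induction x using PartialMap.ind with
  | h U m hm f =>
    obtain ⟨V, g, n, hg, hn, rfl⟩ := hC f
    refine ⟨PartialMap.mk n hn (inv g ≫ m), ?_, ?_⟩
    · rw [comp_def, rest_def, dom_mk, mk_comp_mk_of_factor g rfl]
      exact mk_congr rfl (by simp)
    · rw [comp_def, rest_def, dom_mk, mk_comp_mk_of_factor (inv g) rfl]
      exact mk_congr rfl (by simp)

end BoundedInclusionCategory

/-! ### Functoriality of partial morphisms in 1-cells and 2-cells -/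

theorem RestrictionFunctor.hext {X Y : RestrictionCategory.{u}} {F G : RestrictionFunctor X Y}
    (hobj : ∀ A, F.obj A = G.obj A) (hmap : ∀ {A B} (f : A ⟶ B), F.map f ≍ G.map f) : F = G := by
  have h : F.toFunctor = G.toFunctor := Functor.hext hobj fun _ _ f => hmap f
  cases F; cases G; cases h; rfl

theorem BoundedInclusionFunctor.hext {C D : BoundedInclusionCategory.{u}}
    {F G : BoundedInclusionFunctor C D} (hobj : ∀ A, F.obj A = G.obj A)
    (hmap : ∀ {A B} (f : A ⟶ B), F.map f ≍ G.map f) : F = G := by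
  have h : F.toFunctor = G.toFunctor := Functor.hext hobj fun _ _ f => hmap f
  cases F; cases G; cases h; rfl

namespace BoundedInclusionFunctor

variable {C D E : BoundedInclusionCategory.{u}}

/-- The action of an inclusion functor on maximal objects. -/
def mapMaxObj (F : BoundedInclusionFunctor C D) (A : MaxObj C.carrier) : MaxObj D.carrier :=
  ⟨F.obj A.obj, by rw [← F.map_id]; exact F.map_maximal _ A.isMax⟩

/-- The action of an inclusion functor on partial morphisms. -/
def mapPartialMap (F : BoundedInclusionFunctor C D) {A B : C.carrier} (x : PartialMap A B) :
    PartialMap (F.obj A) (F.obj B) :=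
  Quotient.map (fun s => ⟨F.obj s.dom, F.map s.inc, F.map_incl _ s.incl_inc, F.map s.map⟩)
    (by
      rintro s t ⟨φ, h₁, h₂⟩
      exact ⟨F.mapIso φ, by simp [← h₁], by simp [← h₂]⟩) x

@[simp]
theorem mapPartialMap_mk (F : BoundedInclusionFunctor C D) {A B U : C.carrier} (m : U ⟶ A)
    (hm : incl m) (f : U ⟶ B) :
    F.mapPartialMap (PartialMap.mk m hm f) = PartialMap.mk (F.map m) (F.map_incl m hm) (F.map f) :=
  rfl

theorem mapPartialMap_comp (F : BoundedInclusionFunctor C D) {A B B' : C.carrier}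
    (x : PartialMap A B) (y : PartialMap B B') :
    F.mapPartialMap (x.comp y) = (F.mapPartialMap x).comp (F.mapPartialMap y) := by
  induction x using PartialMap.ind with
  | h U m hm f =>
  induction y using PartialMap.ind with
  | h V n hn g =>
    obtain ⟨P, p, q, hq, hP⟩ := incl_pullback n f hn
    rw [mk_comp_mk hq hP, mapPartialMap_mk, mapPartialMap_mk,
      mapPartialMap_mk, mk_comp_mk (F.map_incl q hq) (F.map_pullback _ _ _ _ hn hP)]
    exact mk_congr (F.map_comp _ _) (F.map_comp _ _)

/-- The restriction functor induced on partial morphisms by an inclusion functor. -/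
noncomputable def mapPartialMaps (F : BoundedInclusionFunctor C D) :
    RestrictionFunctor C.partialMaps D.partialMaps where
  obj A := F.mapMaxObj A
  map x := F.mapPartialMap x
  map_id A := mk_congr (F.map_id _) (F.map_id _)
  map_comp x y := F.mapPartialMap_comp x y
  map_rest x := by
    induction x using PartialMap.ind with
    | h U m hm f => rfl

theorem mapPartialMaps_id (C : BoundedInclusionCategory.{u}) :
    (BoundedInclusionFunctor.id C).mapPartialMaps = RestrictionFunctor.id C.partialMaps := by
  refine RestrictionFunctor.hext (fun _ => rfl) fun x => heq_of_eq ?_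
  induction x using PartialMap.ind with
  | h _ m hm f => rfl

theorem mapPartialMaps_comp (F : BoundedInclusionFunctor C D) (G : BoundedInclusionFunctor D E) :
    (F.comp G).mapPartialMaps = F.mapPartialMaps.comp G.mapPartialMaps := by
  refine RestrictionFunctor.hext (fun _ => rfl) fun x => heq_of_eq ?_
  induction x using PartialMap.ind with
  | h _ m hm f => rfl

end BoundedInclusionFunctor

/-- For a span (m, f) out of U both sides are the span (F m, φ_U G(f)). The factor F(dom x) cuts the
right-hand side down to F U; without it the domain would be the whole pullback of G m along φ_A. -/
theorem InclusionNatTrans.partialMap_naturality {C D : BoundedInclusionCategory.{u}}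
    {F G : BoundedInclusionFunctor C D} (φ : InclusionNatTrans F G) {A B : C.carrier}
    (x : PartialMap A B) :
    (F.mapPartialMap x).comp (PartialMap.mk (𝟙 _) (incl_id _) (φ.app B)) =
      (F.mapPartialMap x.dom).comp
        ((PartialMap.mk (𝟙 _) (incl_id _) (φ.app A)).comp (G.mapPartialMap x)) := by
  induction x using PartialMap.ind with
  | h U m hm f =>
    obtain ⟨P, p, q, hq, hP⟩ := incl_pullback (G.map m) (φ.app A) (G.map_incl m hm)
    -- The naturality square at m places F U inside that pullback.
    obtain ⟨k, hk₁, hk₂⟩ := hP.exists_lift (φ.app U) (F.map m) (φ.naturality m).symm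
    simp only [dom_mk, BoundedInclusionFunctor.mapPartialMap_mk]
    rw [mk_comp_mk hq hP, mk_comp_mk_of_factor (F.map f) (Category.comp_id _),
      mk_comp_mk_of_factor k (by rw [Category.comp_id, hk₂]), ← Category.assoc, hk₁, φ.naturality]

/-- Now the naturality square at m is itself the pullback that computes the right-hand composite, so
no restriction factor is needed. -/
theorem TotalInclusionNatTrans.partialMap_naturality {C D : BoundedInclusionCategory.{u}}
    {F G : BoundedInclusionFunctor C D} (φ : TotalInclusionNatTrans F G) {A B : C.carrier}
    (x : PartialMap A B) :
    (F.mapPartialMap x).comp (PartialMap.mk (𝟙 _) (incl_id _) (φ.app B)) =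
      (PartialMap.mk (𝟙 _) (incl_id _) (φ.app A)).comp (G.mapPartialMap x) := by
  induction x using PartialMap.ind with
  | h U m hm f =>
    simp only [BoundedInclusionFunctor.mapPartialMap_mk]
    rw [mk_comp_mk (F.map_incl m hm) (φ.isPullback m hm), mk_comp_mk_of_factor (F.map f)
      (Category.comp_id _), φ.naturality]
    exact mk_congr (Category.comp_id _).symm rfl

/-- The restriction natural transformation induced on partial morphisms by a natural
transformation. -/
noncomputable def InclusionNatTrans.mapPartialMaps {C D : BoundedInclusionCategory.{u}}
    {F G : BoundedInclusionFunctor C D} (φ : InclusionNatTrans F G) :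
    RestrictionNatTrans F.mapPartialMaps G.mapPartialMaps where
  app A := PartialMap.mk (𝟙 (F.obj A.obj)) (incl_id _) (φ.app A.obj)
  total _ := rfl
  naturality x := φ.partialMap_naturality x

/-- The total natural transformation induced on partial morphisms by a total natural
transformation. -/
noncomputable def TotalInclusionNatTrans.mapPartialMaps {C D : BoundedInclusionCategory.{u}}
    {F G : BoundedInclusionFunctor C D} (φ : TotalInclusionNatTrans F G) :
    TotalRestrictionNatTrans F.mapPartialMaps G.mapPartialMaps where
  app A := PartialMap.mk (𝟙 (F.obj A.obj)) (incl_id _) (φ.app A.obj)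
  total _ := rfl
  naturality x := φ.partialMap_naturality x

/-! ### Strict sections of fully faithful functors -/

namespace CategoryTheory.Functor

variable {C D : Type u} [Category.{u} C] [Category.{u} D] (F : C ⥤ D) [F.Full] [F.Faithful]
  (s : D → C) (hs : ∀ d, F.obj (s d) = d)

/-- The functor determined by a section on objects of a fully faithful functor. -/
noncomputable abbrev ofSection : D ⥤ C where
  obj := s
  map f := F.preimage (eqToHom (hs _) ≫ f ≫ eqToHom (hs _).symm)
  map_id d := F.map_injective (by simp)
  map_comp f g := F.map_injective (by simp)

theorem map_ofSection_map {d d' : D} (f : d ⟶ d') :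
    F.map ((F.ofSection s hs).map f) = eqToHom (hs _) ≫ f ≫ eqToHom (hs _).symm :=
  F.map_preimage _

theorem map_ofSection_map_heq {d d' : D} (f : d ⟶ d') :
    F.map ((F.ofSection s hs).map f) ≍ f :=
  (conj_eqToHom_iff_heq _ _ (hs _) (hs _)).1 (F.map_ofSection_map s hs f)

theorem ofSection_map_map_heq (hinj : Function.Injective F.obj) {c c' : C} (f : c ⟶ c') :
    (F.ofSection s hs).map (F.map f) ≍ f := by
  refine (conj_eqToHom_iff_heq _ _ (hinj (hs _)) (hinj (hs _))).1 (F.map_injective ?_)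
  rw [map_ofSection_map]
  simp [eqToHom_map]

end CategoryTheory.Functor

theorem RestrictionStructure.rest_eqToHom_conj {X : Type u} [Category.{u} X]
    [RestrictionStructure X] {A A' B B' : X} (h : A' = A) (h' : B = B') (f : A ⟶ B) :
    rest (eqToHom h ≫ f ≫ eqToHom h') = eqToHom h ≫ rest f ≫ eqToHom h.symm := by
  subst h h'; simp

theorem InclusionStructure.incl_eqToHom_conj {C : Type u} [Category.{u} C]
    [InclusionStructure C] {A A' B B' : C} (h : A' = A) (h' : B = B') {f : A ⟶ B} (hf : incl f) :
    incl (eqToHom h ≫ f ≫ eqToHom h') := by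
  subst h h'; simpa using hf

theorem InclusionStructure.isMaximalInclusion_eqToHom_conj {C : Type u} [Category.{u} C]
    [InclusionStructure C] {A A' B B' : C} (h : A' = A) (h' : B = B') {f : A ⟶ B}
    (hf : IsMaximalInclusion f) :
    IsMaximalInclusion (eqToHom h ≫ f ≫ eqToHom h') := by
  subst h h'; simpa using hf

namespace RestrictionFunctor

variable {X Y : RestrictionCategory.{u}} (F : RestrictionFunctor X Y) [F.Full] [F.Faithful]
  (s : Y.carrier → X.carrier) (hs : ∀ d, F.obj (s d) = d)

/-- The restriction functor determined by a section on objects of a fully faithful restriction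
functor. -/
noncomputable def ofSection : RestrictionFunctor Y X where
  toFunctor := F.toFunctor.ofSection s hs
  map_rest f := F.map_injective (by
    rw [F.map_rest, F.map_ofSection_map, F.map_ofSection_map, rest_eqToHom_conj])

theorem ofSection_comp : (F.ofSection s hs).comp F = RestrictionFunctor.id Y :=
  RestrictionFunctor.hext hs (F.map_ofSection_map_heq s hs)

/-- The section is a strict one-sided inverse by construction. On the other side s (F c) = c has to
hold on objects, and injectivity gives it. -/
theorem comp_ofSection (hinj : Function.Injective F.obj) :
    F.comp (F.ofSection s hs) = RestrictionFunctor.id X :=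
  RestrictionFunctor.hext (fun _ => hinj (hs _)) (F.ofSection_map_map_heq s hs hinj)

end RestrictionFunctor

namespace BoundedInclusionFunctor

variable {C D : BoundedInclusionCategory.{u}} (F : BoundedInclusionFunctor C D)
  [F.Full] [F.Faithful]
  (hincl : ∀ {A B : C.carrier} (m : A ⟶ B), incl (F.map m) → incl m)
  (hmax : ∀ {A B : C.carrier} (m : A ⟶ B), IsMaximalInclusion (F.map m) → IsMaximalInclusion m)
  (s : D.carrier → C.carrier) (hs : ∀ d, F.obj (s d) = d)

/-- The inclusion functor determined by a section on objects of a fully faithful inclusion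
functor that reflects inclusions and maximal inclusions. -/
noncomputable def ofSection : BoundedInclusionFunctor D C where
  toFunctor := F.toFunctor.ofSection s hs
  map_incl m hm := hincl _ (by
    rw [F.map_ofSection_map]
    exact incl_eqToHom_conj _ _ hm)
  map_pullback g p m f _ h := by
    -- A fully faithful functor reflects pullbacks, and F takes the image square back to the
    -- original one up to transport along `hs`.
    refine IsPullback.of_map F.toFunctor (by rw [← Functor.map_comp, ← Functor.map_comp, h.w]) ?_
    simp only
    exact h.of_iso (eqToIso (hs _).symm) (eqToIso (hs _).symm) (eqToIso (hs _).symm)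
      (eqToIso (hs _).symm) (by simp) (by simp) (by simp) (by simp)
  map_maximal m hm := hmax _ (by
    rw [F.map_ofSection_map]
    exact isMaximalInclusion_eqToHom_conj _ _ hm)

theorem ofSection_comp :
    (F.ofSection hincl hmax s hs).comp F = BoundedInclusionFunctor.id D :=
  BoundedInclusionFunctor.hext hs (F.map_ofSection_map_heq s hs)

theorem comp_ofSection (hinj : Function.Injective F.obj) :
    F.comp (F.ofSection hincl hmax s hs) = BoundedInclusionFunctor.id C :=
  BoundedInclusionFunctor.hext (fun _ => hinj (hs _)) (F.ofSection_map_map_heq s hs hinj)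

/-- The comparison of a composite with a section and the identity, objectwise. -/
noncomputable def compOfSectionIso (A : C.carrier) : s (F.obj A) ≅ A :=
  F.preimageIso (eqToIso (hs _))

theorem map_compOfSectionIso_hom (A : C.carrier) :
    F.map (F.compOfSectionIso s hs A).hom = eqToHom (hs _) := by
  simp [compOfSectionIso]

end BoundedInclusionFunctor

/-! ### The unit: a restriction category as partial maps between its identity idempotents -/

namespace RestIdem

variable {X Y : RestrictionCategory.{u}}

/-- The partial morphism between identity idempotents given by a morphism with restriction
idempotent `d`. -/
def toPartialMap {P Q : RestIdem X} (hP : P.e = 𝟙 _) (hQ : Q.e = 𝟙 _) (f : P.base ⟶ Q.base)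
    (d : P.base ⟶ P.base) (hd : rest f = d) : PartialMap P Q :=
  have h : rest d = d := by rw [← hd, rest_rest]
  PartialMap.mk (U := ⟨P.base, d, h⟩) ⟨d, h, by rw [hP, Category.comp_id]⟩ ⟨_, rfl⟩
    ⟨f, hd, by rw [hQ, Category.comp_id]⟩

/-- The domain d is a free parameter so that it can be given in another form, such as an identity or
F(rest f); this lemma says that the form does not matter. -/
theorem toPartialMap_eq {P Q : RestIdem X} (hP : P.e = 𝟙 _) (hQ : Q.e = 𝟙 _)
    {f : P.base ⟶ Q.base} {d : P.base ⟶ P.base} (hd : rest f = d) :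
    toPartialMap hP hQ f _ rfl = toPartialMap hP hQ f d hd := by
  subst hd; rfl

/-- The inverse image of rest g under f is rest (f g), with f rest g as the leg to the domain of g;
followed by g this leg is again f g. -/
theorem toPartialMap_comp {P Q R : RestIdem X} (hP : P.e = 𝟙 _) (hQ : Q.e = 𝟙 _)
    (hR : R.e = 𝟙 _) (f : P.base ⟶ Q.base) (g : Q.base ⟶ R.base) :
    toPartialMap hP hR (f ≫ g) _ rfl =
      (toPartialMap hP hQ f _ rfl).comp (toPartialMap hQ hR g _ rfl) := by
  obtain ⟨B, e, he⟩ := Q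
  have hfg := rest_comp_rest_left f g
  have hg : (f ≫ rest g) ≫ rest g = f ≫ rest g := by
    have := rest_comp_self (rest g)
    rw [rest_rest] at this
    rw [Category.assoc, this]
  let p : (⟨P.base, rest (f ≫ g), rest_rest _⟩ : RestIdem X) ⟶ ⟨B, rest g, rest_rest _⟩ :=
    ⟨f ≫ rest g, rest_comp_rest f g, hg⟩
  let q : (⟨P.base, rest (f ≫ g), rest_rest _⟩ : RestIdem X) ⟶ ⟨P.base, rest f, rest_rest _⟩ :=
    ⟨rest (f ≫ g), rest_rest _, hfg⟩
  let n : (⟨B, rest g, rest_rest _⟩ : RestIdem X) ⟶ ⟨B, e, he⟩ :=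
    ⟨rest g, rest_rest _, (congrArg (rest g ≫ ·) hQ).trans (Category.comp_id _)⟩
  let k : (⟨P.base, rest f, rest_rest _⟩ : RestIdem X) ⟶ ⟨B, e, he⟩ :=
    ⟨f, rfl, (congrArg (f ≫ ·) hQ).trans (Category.comp_id _)⟩
  have h : IsPullback p q n k :=
    isPullback_of_incl n rfl k (rest_comp_rest f g).symm p rfl q rfl
  refine Eq.trans ?_ (mk_comp_mk ?_ h).symm
  · exact mk_congr (hom_ext hfg.symm)
      (hom_ext ((congrArg (f ≫ ·) (rest_comp_self g)).symm.trans (Category.assoc _ _ _).symm))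
  · exact ⟨_, rfl⟩

/-- An isomorphism of the two spans has underlying morphism rest f, and its inverse has rest g.
Hence rest f g = f and rest g f = g, so each of f and g is a restriction of the other. -/
theorem toPartialMap_injective {P Q : RestIdem X} (hP : P.e = 𝟙 _) (hQ : Q.e = 𝟙 _)
    {f g : P.base ⟶ Q.base}
    (h : toPartialMap hP hQ f _ rfl = toPartialMap hP hQ g _ rfl) : f = g := by
  obtain ⟨φ, h₁, h₂⟩ := mk_eq_mk_iff.1 h
  have h₃ := (Iso.inv_comp_eq φ).2 h₁.symm
  have h₄ := (Iso.inv_comp_eq φ).2 h₂.symm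
  have k₁ : φ.hom.f = rest f := φ.hom.comp_e.symm.trans (congrArg Hom.f h₁)
  have k₂ : φ.hom.f ≫ g = f := congrArg Hom.f h₂
  have k₃ : φ.inv.f = rest g := φ.inv.comp_e.symm.trans (congrArg Hom.f h₃)
  have k₄ : φ.inv.f ≫ f = g := congrArg Hom.f h₄
  have k₂ : rest f ≫ g = f := (congrArg (· ≫ g) k₁).symm.trans k₂
  have k₄ : rest g ≫ f = g := (congrArg (· ≫ f) k₃).symm.trans k₄
  calc f = rest f ≫ rest g ≫ f := by rw [k₄, k₂]
    _ = rest g ≫ f := by rw [← Category.assoc, rest_comm, Category.assoc, rest_comp_self]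
    _ = g := k₄

/-- The domain of a span into P is an idempotent on the base of P, so the right leg is already a
morphism of X between the bases and its domain recovers the left leg. -/
theorem toPartialMap_surjective {P Q : RestIdem X} (hP : P.e = 𝟙 _) (hQ : Q.e = 𝟙 _)
    (x : PartialMap P Q) : ∃ f, toPartialMap hP hQ f _ rfl = x := by
  induction x using PartialMap.ind with
  | h U m hm k =>
    obtain ⟨m, hm⟩ := hm
    refine ⟨k.f, (toPartialMap_eq hP hQ k.rest_f).trans ?_⟩
    exact mk_congr (hom_ext hm.symm) rfl

theorem isMaximalInclusion_id_iff {P : RestIdem X} : IsMaximalInclusion (𝟙 P) ↔ P.e = 𝟙 _ := by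
  rw [isMaximalInclusion_iff]
  exact and_iff_right (incl_id P)

/-- The identity idempotent on an object. -/
def top (A : X.carrier) : MaxObj (RestIdem X) :=
  ⟨⟨A, 𝟙 A, rest_id A⟩, isMaximalInclusion_id_iff.2 rfl⟩

variable (X) in
/-- The comparison of a restriction category with the partial morphisms between its identity
idempotents. -/
noncomputable def unitFunctor : RestrictionFunctor X (boundedInclusionCategory X).partialMaps where
  obj A := top A
  map f := toPartialMap (P := (top _).obj) (Q := (top _).obj) rfl rfl f _ rfl
  map_id A := toPartialMap_eq _ _ (rest_id A)
  map_comp f g := 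
    toPartialMap_comp (P := (top _).obj) (Q := (top _).obj) (R := (top _).obj) rfl rfl rfl f g
  map_rest f := toPartialMap_eq _ _ (rest_rest f)

instance : (unitFunctor X).Faithful where
  map_injective h := toPartialMap_injective rfl rfl h

instance : (unitFunctor X).Full where
  map_surjective x := toPartialMap_surjective rfl rfl x

theorem unitFunctor_obj_base (P : MaxObj (RestIdem X)) : (unitFunctor X).obj P.obj.base = P := by
  obtain ⟨⟨A, e, he⟩, hP⟩ := P
  have := isMaximalInclusion_id_iff.1 hP
  simp only at this
  subst this
  rfl

theorem unitFunctor_obj_injective : Function.Injective (unitFunctor X).obj := fun _ _ h =>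
  congrArg (fun P : MaxObj (RestIdem X) => P.obj.base) h

/-- A functor sends the identity idempotent on A to F(𝟙 A), which equals the identity only
propositionally. With all idempotents variable, the strict naturality of the unit reduces to
substitution. -/
theorem toPartialMap_heq {A B : X.carrier} {e e₁ : A ⟶ A} {he : rest e = e} {he₁ : rest e₁ = e₁}
    {e' e₁' : B ⟶ B} {he' : rest e' = e'} {he₁' : rest e₁' = e₁'}
    (h : e = 𝟙 A) (h₁ : e₁ = 𝟙 A) (h' : e' = 𝟙 B) (h₁' : e₁' = 𝟙 B) {f g : A ⟶ B} (hfg : f = g)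
    {d d₁ : A ⟶ A} (hd : rest f = d) (hd₁ : rest g = d₁) :
    toPartialMap (P := ⟨A, e, he⟩) (Q := ⟨B, e', he'⟩) h h' f d hd ≍
      toPartialMap (P := ⟨A, e₁, he₁⟩) (Q := ⟨B, e₁', he₁'⟩) h₁ h₁' g d₁ hd₁ := by
  subst h h₁ h' h₁' hfg hd hd₁
  rfl

theorem top_map (F : RestrictionFunctor X Y) (A : X.carrier) :
    top (F.obj A) = (map F).mapMaxObj (top A) := by
  simp only [top, BoundedInclusionFunctor.mapMaxObj, map, mapFunctor]
  congr 2
  exact (F.map_id A).symm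

theorem unitFunctor_naturality (F : RestrictionFunctor X Y) :
    F.comp (unitFunctor Y) = (unitFunctor X).comp (map F).mapPartialMaps :=
  RestrictionFunctor.hext (top_map F) fun f =>
    toPartialMap_heq rfl (F.map_id _) rfl (F.map_id _) rfl rfl (F.map_rest f).symm

theorem unitFunctor_map_app {F G : RestrictionFunctor X Y} (φ : RestrictionNatTrans F G)
    (A : X.carrier) :
    (unitFunctor Y).map (φ.app A) ≍ (mapNat φ).mapPartialMaps.app ((unitFunctor X).obj A) :=
  toPartialMap_heq rfl (F.map_id _) rfl (G.map_id _) 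
    (((congrArg (· ≫ φ.app A) (F.map_id A)).trans (Category.id_comp _)).symm) rfl
    ((rest_comp_of_isTotal _ (φ.total _)).trans
      ((F.map_rest _).symm.trans (congrArg F.map (rest_id A))))

theorem unitFunctor_map_total_app {F G : RestrictionFunctor X Y} (φ : TotalRestrictionNatTrans F G)
    (A : X.carrier) :
    (unitFunctor Y).map (φ.app A) ≍ (mapTotalNat φ).mapPartialMaps.app ((unitFunctor X).obj A) :=
  toPartialMap_heq rfl (F.map_id _) rfl (G.map_id _) 
    (((congrArg (· ≫ φ.app A) (F.map_id A)).trans (Category.id_comp _)).symm) rfl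
    ((rest_comp_of_isTotal _ (φ.total _)).trans
      ((F.map_rest _).symm.trans (congrArg F.map (rest_id A))))

end RestIdem

/-! ### The counit: objects as idempotents on maximal objects -/

theorem RestIdem.IsIncl.base_eq {X : RestrictionCategory.{u}} {P Q : RestIdem X} {m : P ⟶ Q}
    (hm : RestIdem.IsIncl m) : P.base = Q.base := by
  cases hm; rfl

theorem RestIdem.IsIncl.heq {X : RestrictionCategory.{u}} {P Q : RestIdem X} {m : P ⟶ Q}
    (hm : RestIdem.IsIncl m) : m.f ≍ P.e := by
  obtain ⟨m, hm⟩ := hm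
  exact heq_of_eq hm

namespace BoundedInclusionCategory

variable {C D : BoundedInclusionCategory.{u}}

theorem isMaximalInclusion_id {A L : C.carrier} {η : A ⟶ L} (h : IsMaximalInclusion η) :
    IsMaximalInclusion (𝟙 L) :=
  ⟨incl_id L, h.2⟩

/-- The idempotent partial morphism given by a maximal inclusion. -/
def ofMaximal {A L : C.carrier} (η : A ⟶ L) (hη : IsMaximalInclusion η) :
    RestIdem C.partialMaps :=
  ⟨⟨L, isMaximalInclusion_id hη⟩, PartialMap.mk η hη.1 η, rfl⟩

/-- The morphism of idempotent partial morphisms induced by a morphism. -/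
noncomputable def ofMaximalMap {A B L M : C.carrier} {η : A ⟶ L} (hη : IsMaximalInclusion η)
    {θ : B ⟶ M} (hθ : IsMaximalInclusion θ) (f : A ⟶ B) : ofMaximal η hη ⟶ ofMaximal θ hθ :=
  ⟨PartialMap.mk η hη.1 (f ≫ θ), rfl, mk_comp_mk_of_factor f rfl⟩

theorem ofMaximalMap_id {A L : C.carrier} {η : A ⟶ L} (hη : IsMaximalInclusion η) :
    ofMaximalMap hη hη (𝟙 A) = 𝟙 _ :=
  RestIdem.hom_ext (mk_congr rfl (Category.id_comp _))

theorem ofMaximalMap_comp {A B D L M N : C.carrier} {η : A ⟶ L} (hη : IsMaximalInclusion η)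
    {θ : B ⟶ M} (hθ : IsMaximalInclusion θ) {κ : D ⟶ N} (hκ : IsMaximalInclusion κ) (f : A ⟶ B)
    (g : B ⟶ D) :
    ofMaximalMap hη hκ (f ≫ g) = ofMaximalMap hη hθ f ≫ ofMaximalMap hθ hκ g :=
  RestIdem.hom_ext ((mk_congr rfl (Category.assoc _ _ _)).trans (mk_comp_mk_of_factor f rfl).symm)

/-- An automorphism of A over the monic η is the identity, so the right legs agree and the monic θ
cancels. -/
theorem ofMaximalMap_injective {A B L M : C.carrier} {η : A ⟶ L} (hη : IsMaximalInclusion η)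
    {θ : B ⟶ M} (hθ : IsMaximalInclusion θ) {f g : A ⟶ B}
    (h : ofMaximalMap hη hθ f = ofMaximalMap hη hθ g) : f = g := by
  have := incl_mono η hη.1
  have := incl_mono θ hθ.1
  obtain ⟨φ, h₁, h₂⟩ := mk_eq_mk_iff.1 (congrArg RestIdem.Hom.f h)
  have h₂ : φ.hom ≫ g ≫ θ = f ≫ θ := h₂
  rw [(cancel_mono_id η).1 h₁, Category.id_comp] at h₂
  exact ((cancel_mono θ).1 h₂).symm

theorem ofMaximalMap_surjective {A B L M : C.carrier} {η : A ⟶ L} (hη : IsMaximalInclusion η)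
    {θ : B ⟶ M} (hθ : IsMaximalInclusion θ) (x : ofMaximal η hη ⟶ ofMaximal θ hθ) :
    ∃ f, ofMaximalMap hη hθ f = x := by
  obtain ⟨x, hx, hx'⟩ := x
  change PartialMap L M at x
  change x.dom = PartialMap.mk η hη.1 η at hx
  change x.comp (PartialMap.mk θ hθ.1 θ) = x at hx'
  induction x using PartialMap.ind with
  | h U m hm k =>
    obtain ⟨φ, h₁, -⟩ := mk_eq_mk_iff.1 hx
    obtain ⟨P, p, q, hq, hP⟩ := incl_pullback θ k hθ.1
    rw [mk_comp_mk hq hP] at hx'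
    -- That x absorbs the idempotent of θ means that pulling θ back along k loses nothing of U. So k
    -- factors through θ, and transporting the factor along φ gives the required morphism out of A.
    obtain ⟨ψ, h₂, h₃⟩ := mk_eq_mk_iff.1 hx'
    refine ⟨φ.inv ≫ ψ.inv ≫ p, RestIdem.hom_ext ?_⟩
    refine mk_eq_mk φ.symm ?_ ?_
    · exact (Iso.inv_comp_eq φ).2 h₁.symm
    · have h₄ : ψ.inv ≫ p ≫ θ = k := (Iso.inv_comp_eq ψ).2 h₃.symm
      calc φ.inv ≫ k = φ.inv ≫ ψ.inv ≫ p ≫ θ := congrArg (φ.inv ≫ ·) h₄.symm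
        _ = (φ.inv ≫ ψ.inv ≫ p) ≫ θ := by simp only [Category.assoc]

theorem eq_of_isMaximalInclusion {A : C.carrier} {p q : Σ L : C.carrier, (A ⟶ L)}
    (hp : IsMaximalInclusion p.2) (hq : IsMaximalInclusion q.2) : p = q :=
  (C.bounded A).unique hp hq

/-- Uniqueness of maximal inclusions makes the construction independent of the one used. In
particular F(η_A) may stand for the chosen maximal inclusion of F A. -/
theorem ofMaximal_congr {A L M : C.carrier} {η : A ⟶ L} (hη : IsMaximalInclusion η)
    {θ : A ⟶ M} (hθ : IsMaximalInclusion θ) : ofMaximal η hη = ofMaximal θ hθ := by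
  cases eq_of_isMaximalInclusion (p := ⟨L, η⟩) (q := ⟨M, θ⟩) hη hθ
  rfl

theorem ofMaximalMap_heq {A B L M L' M' : C.carrier} {η : A ⟶ L} (hη : IsMaximalInclusion η)
    {θ : B ⟶ M} (hθ : IsMaximalInclusion θ) {η' : A ⟶ L'} (hη' : IsMaximalInclusion η')
    {θ' : B ⟶ M'} (hθ' : IsMaximalInclusion θ') (f : A ⟶ B) :
    ofMaximalMap hη hθ f ≍ ofMaximalMap hη' hθ' f := by
  cases eq_of_isMaximalInclusion (p := ⟨L, η⟩) (q := ⟨L', η'⟩) hη hη'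
  cases eq_of_isMaximalInclusion (p := ⟨M, θ⟩) (q := ⟨M', θ'⟩) hθ hθ'
  rfl

/-- The composite of m with θ is again a maximal inclusion of A, hence it is η. Both idempotents
therefore live on the same object. -/
theorem incl_ofMaximalMap {A B L M : C.carrier} {η : A ⟶ L} (hη : IsMaximalInclusion η)
    {θ : B ⟶ M} (hθ : IsMaximalInclusion θ) {m : A ⟶ B} (hm : incl m) :
    incl (ofMaximalMap hη hθ m) := by
  cases eq_of_isMaximalInclusion (p := ⟨L, η⟩) (q := ⟨M, m ≫ θ⟩) hη
    ⟨incl_comp _ _ hm hθ.1, hθ.2⟩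
  exact ⟨_, rfl⟩

/-- An inclusion of idempotents forces L = M and equates the span (η, m θ) with (η, η), whence m θ =
η. Concluding that m itself is an inclusion then takes cancellativity. -/
theorem incl_comp_of_incl_ofMaximalMap {A B L M : C.carrier} {η : A ⟶ L}
    (hη : IsMaximalInclusion η) {θ : B ⟶ M} (hθ : IsMaximalInclusion θ) {m : A ⟶ B}
    (hm : incl (ofMaximalMap hη hθ m)) : incl (m ≫ θ) := by
  have h : L = M := congrArg MaxObj.obj hm.base_eq
  subst h
  obtain ⟨φ, h₁, h₂⟩ := mk_eq_mk_iff.1 (eq_of_heq hm.heq)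
  have h : m ≫ θ = η := h₂.symm.trans h₁
  exact h.symm ▸ hη.1

theorem isIso_of_ofMaximal_e_eq_id {A L : C.carrier} {η : A ⟶ L} (hη : IsMaximalInclusion η)
    (h : (ofMaximal η hη).e = 𝟙 _) : IsIso η := by
  obtain ⟨φ, h₁, -⟩ : ∃ φ : A ≅ L, φ.hom ≫ 𝟙 L = η ∧ _ := mk_eq_mk_iff.1 h
  have : φ.hom = η := (Category.comp_id _).symm.trans h₁
  rw [← this]
  infer_instance

theorem incl_inv (hC : C.IsCancellative) {A B : C.carrier} (m : A ⟶ B) [IsIso m] (hm : incl m) :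
    incl (inv m) :=
  hC _ m hm (by rw [IsIso.inv_hom_id]; exact incl_id _)

variable (C) in
/-- The domain of the maximal inclusion of an object. -/
noncomputable def maxObj (A : C.carrier) : C.carrier := (C.bounded A).choose.1

/-- The maximal inclusion of an object. -/
noncomputable def maxIncl (A : C.carrier) : A ⟶ C.maxObj A := (C.bounded A).choose.2

theorem maxIncl_isMaximal (A : C.carrier) : IsMaximalInclusion (maxIncl A) :=
  (C.bounded A).choose_spec.1

variable (C) in
/-- The comparison of a bounded inclusion category with the idempotent partial morphisms between
its maximal objects. -/
noncomputable def counitFunctor : C.carrier ⥤ RestIdem C.partialMaps where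
  obj A := ofMaximal (maxIncl A) (maxIncl_isMaximal A)
  map f := ofMaximalMap _ _ f
  map_id _ := ofMaximalMap_id _
  map_comp f g := ofMaximalMap_comp _ _ _ f g

instance : C.counitFunctor.Faithful where
  map_injective h := ofMaximalMap_injective _ _ h

instance : C.counitFunctor.Full where
  map_surjective x := ofMaximalMap_surjective _ _ x

theorem counitFunctor_obj_surjective : Function.Surjective C.counitFunctor.obj := by
  rintro ⟨⟨A, hA⟩, e, he⟩
  change PartialMap A A at e
  change e.dom = e at he
  induction e using PartialMap.ind with
  | h U m hm f =>
    -- A is maximal, so m is the maximal inclusion of U, and the idempotent (m, m) is the image of U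
    -- on the nose.
    have hm' : IsMaximalInclusion m := ⟨hm, hA.2⟩
    refine ⟨U, (ofMaximal_congr (maxIncl_isMaximal U) hm').trans ?_⟩
    unfold ofMaximal
    congr 1

/-- Equal idempotents are equal classes of spans, which gives only an isomorphism A ≅ B over the
common maximal object; skeletality turns it into an equality. -/
theorem counitFunctor_obj_injective (hC : C.IsSkeletal) :
    Function.Injective C.counitFunctor.obj := by
  intro A B h
  have hA := maxIncl_isMaximal A
  have hB := maxIncl_isMaximal B
  change ofMaximal _ hA = ofMaximal _ hB at h
  -- The chosen maximal inclusions become variables so that the equality of their codomains can be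
  -- substituted.
  generalize maxIncl A = η at *
  generalize maxIncl B = θ at *
  generalize C.maxObj A = L at *
  generalize C.maxObj B = M at *
  have hLM : L = M := congrArg (fun P : RestIdem C.partialMaps => P.base.obj) h
  subst hLM
  injection h with _ h
  obtain ⟨φ, h₁, -⟩ := mk_eq_mk_iff.1 h
  exact hC η θ hA.1 hB.1 φ h₁

/-- The comparison functor of a bounded inclusion category as an inclusion functor. -/
noncomputable def counit (C : BoundedInclusionCategory.{u}) :
    BoundedInclusionFunctor C (RestIdem.boundedInclusionCategory C.partialMaps) where
  toFunctor := C.counitFunctor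
  map_incl m hm := incl_ofMaximalMap _ _ hm
  map_pullback g p m f _ h := by
    have : C.counitFunctor.EssSurj := ⟨fun P =>
      have ⟨A, hA⟩ := counitFunctor_obj_surjective P
      ⟨A, ⟨eqToIso hA⟩⟩⟩
    have : C.counitFunctor.IsEquivalence := {}
    exact h.map C.counitFunctor
  map_maximal {A L} m hm := by
    refine (RestIdem.isMaximalInclusion_iff _).2 ⟨incl_ofMaximalMap _ _ hm.1, ?_⟩
    have hL := maxIncl_isMaximal L
    change (ofMaximal (maxIncl L) hL).e = 𝟙 (ofMaximal (maxIncl L) hL).base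
    rw [ofMaximal_congr (maxIncl_isMaximal L) (isMaximalInclusion_id hm)]
    rfl

instance : C.counit.Faithful := inferInstanceAs C.counitFunctor.Faithful

instance : C.counit.Full := inferInstanceAs C.counitFunctor.Full

theorem incl_of_incl_counit_map (hC : C.IsCancellative) {A B : C.carrier} (m : A ⟶ B)
    (hm : incl (C.counit.map m)) : incl m :=
  hC _ _ (maxIncl_isMaximal B).1 (incl_comp_of_incl_ofMaximalMap _ _ hm)

/-- If the idempotent of B is the identity, then η_B is invertible, and by cancellativity its
inverse is an inclusion LB → B. Every inclusion out of B thus yields one out of LB, and maximality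
of LB forces all the codomains to coincide. -/
theorem isMaximalInclusion_of_counit_map (hC : C.IsCancellative) {A B : C.carrier} (m : A ⟶ B)
    (hm : IsMaximalInclusion (C.counit.map m)) : IsMaximalInclusion m := by
  obtain ⟨h₁, h₂⟩ := (RestIdem.isMaximalInclusion_iff _).1 hm
  refine ⟨incl_of_incl_counit_map hC m h₁, fun B' x hx => ?_⟩
  have hB := maxIncl_isMaximal B
  have := isIso_of_ofMaximal_e_eq_id hB h₂
  have hi := incl_inv hC _ hB.1
  exact (hB.2 _ _ hi).symm.trans (hB.2 _ _ (incl_comp _ _ hi hx))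

/-- The equality is strict because F(η_A) is the maximal inclusion of F A. -/
theorem counit_naturality (F : BoundedInclusionFunctor C D) :
    F.comp D.counit = C.counit.comp (RestIdem.map F.mapPartialMaps) :=
  BoundedInclusionFunctor.hext
    (fun A => ofMaximal_congr (maxIncl_isMaximal _) (F.map_maximal _ (maxIncl_isMaximal A)))
    fun {A B} _ => (ofMaximalMap_heq _ _ (F.map_maximal _ (maxIncl_isMaximal A))
      (F.map_maximal _ (maxIncl_isMaximal B)) _).trans
        (heq_of_eq (RestIdem.hom_ext (mk_congr rfl (F.map_comp _ _).symm)))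

theorem counit_map_app {F G : BoundedInclusionFunctor C D} (φ : InclusionNatTrans F G)
    (A : C.carrier) :
    D.counit.map (φ.app A) ≍ (RestIdem.mapNat φ.mapPartialMaps).app (C.counit.obj A) :=
  (ofMaximalMap_heq _ _ (F.map_maximal _ (maxIncl_isMaximal A))
      (G.map_maximal _ (maxIncl_isMaximal A)) _).trans
    (heq_of_eq (RestIdem.hom_ext ((mk_congr rfl (φ.naturality _).symm).trans
      (mk_comp_mk_of_factor _ (Category.comp_id _)).symm)))

theorem counit_map_total_app {F G : BoundedInclusionFunctor C D} (φ : TotalInclusionNatTrans F G)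
    (A : C.carrier) :
    D.counit.map (φ.app A) ≍ (RestIdem.mapTotalNat φ.mapPartialMaps).app (C.counit.obj A) :=
  (ofMaximalMap_heq _ _ (F.map_maximal _ (maxIncl_isMaximal A))
      (G.map_maximal _ (maxIncl_isMaximal A)) _).trans
    (heq_of_eq (RestIdem.hom_ext ((mk_congr rfl (φ.naturality _).symm).trans
      (mk_comp_mk_of_factor _ (Category.comp_id _)).symm)))

end BoundedInclusionCategory

/-! ### Compatibility of the constructions with the 2-categorical structure -/

open Bicategory in
theorem IsIsoOneCell.isEquivOneCell {B : Type*} [Bicategory B] {a b : B} {f : a ⟶ b}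
    (hf : IsIsoOneCell f) : IsEquivOneCell f :=
  let ⟨g, h₁, h₂⟩ := hf
  ⟨g, ⟨eqToIso h₁⟩, ⟨eqToIso h₂⟩⟩

namespace RestIdem

variable {X Y Z : RestrictionCategory.{u}}

/-- The right-hand side carries an extra factor G(e), which F(e) φ_A absorbs. -/
theorem mapNat_vcomp {F G H : RestrictionFunctor X Y} (φ : RestrictionNatTrans F G)
    (ψ : RestrictionNatTrans G H) : mapNat (φ.vcomp ψ) = (mapNat φ).vcomp (mapNat ψ) := by
  refine InclusionNatTrans.ext (funext fun P => hom_ext ?_)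
  have h : (F.map P.e ≫ φ.app P.base) ≫ G.map P.e = F.map P.e ≫ φ.app P.base :=
    ((mapNat φ).app P).comp_e
  change F.map P.e ≫ φ.app P.base ≫ ψ.app P.base =
    (F.map P.e ≫ φ.app P.base) ≫ G.map P.e ≫ ψ.app P.base
  rw [← Category.assoc _ (G.map P.e), h, Category.assoc]

theorem mapNat_whiskerRight_app {F G : RestrictionFunctor X Y} (φ : RestrictionNatTrans F G)
    (K : RestrictionFunctor Y Z) (P : RestIdem X) :
    (mapNat (φ.whiskerRight K)).app P = ((mapNat φ).whiskerRight (map K)).app P :=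
  hom_ext (K.map_comp (F.map P.e) (φ.app P.base)).symm

theorem mapTotalNat_vcomp {F G H : RestrictionFunctor X Y} (φ : TotalRestrictionNatTrans F G)
    (ψ : TotalRestrictionNatTrans G H) :
    mapTotalNat (φ.vcomp ψ) = (mapTotalNat φ).vcomp (mapTotalNat ψ) := by
  refine TotalInclusionNatTrans.ext (funext fun P => hom_ext ?_)
  have h : (F.map P.e ≫ φ.app P.base) ≫ G.map P.e = F.map P.e ≫ φ.app P.base :=
    ((mapTotalNat φ).app P).comp_e
  change F.map P.e ≫ φ.app P.base ≫ ψ.app P.base =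
    (F.map P.e ≫ φ.app P.base) ≫ G.map P.e ≫ ψ.app P.base
  rw [← Category.assoc _ (G.map P.e), h, Category.assoc]

theorem mapTotalNat_whiskerRight_app {F G : RestrictionFunctor X Y}
    (φ : TotalRestrictionNatTrans F G) (K : RestrictionFunctor Y Z) (P : RestIdem X) :
    (mapTotalNat (φ.whiskerRight K)).app P = ((mapTotalNat φ).whiskerRight (map K)).app P :=
  hom_ext (K.map_comp (F.map P.e) (φ.app P.base)).symm

end RestIdem

namespace BoundedInclusionFunctor

variable {C D : BoundedInclusionCategory.{u}} (F : BoundedInclusionFunctor C D)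
  [F.Full] [F.Faithful]
  (hincl : ∀ {A B : C.carrier} (m : A ⟶ B), incl (F.map m) → incl m)
  (hmax : ∀ {A B : C.carrier} (m : A ⟶ B), IsMaximalInclusion (F.map m) → IsMaximalInclusion m)
  (s : D.carrier → C.carrier) (hs : ∀ d, F.obj (s d) = d)

theorem compOfSectionIso_hom_naturality {A B : C.carrier} (f : A ⟶ B) :
    (F.toFunctor.ofSection s hs).map (F.map f) ≫ (F.compOfSectionIso s hs B).hom =
      (F.compOfSectionIso s hs A).hom ≫ f := by
  refine F.map_injective ?_
  rw [F.map_comp, F.map_comp, map_compOfSectionIso_hom, map_compOfSectionIso_hom,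
    F.map_ofSection_map]
  simp

theorem compOfSectionIso_inv_naturality {A B : C.carrier} (f : A ⟶ B) :
    f ≫ (F.compOfSectionIso s hs B).inv =
      (F.compOfSectionIso s hs A).inv ≫ (F.toFunctor.ofSection s hs).map (F.map f) := by
  rw [Iso.eq_inv_comp, ← Category.assoc, Iso.comp_inv_eq]
  exact (F.compOfSectionIso_hom_naturality s hs f).symm

/-- A naturality square with invertible components is a pullback, so the comparison isomorphism is
also a 2-cell when pullback squares at inclusions are required. -/
theorem isPullback_compOfSectionIso_hom {U A : C.carrier} (m : U ⟶ A) :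
    IsPullback (F.compOfSectionIso s hs U).hom ((F.toFunctor.ofSection s hs).map (F.map m)) m
      (F.compOfSectionIso s hs A).hom :=
  IsPullback.of_horiz_isIso ⟨(F.compOfSectionIso_hom_naturality s hs m).symm⟩

theorem isPullback_compOfSectionIso_inv {U A : C.carrier} (m : U ⟶ A) :
    IsPullback (F.compOfSectionIso s hs U).inv m
      ((F.toFunctor.ofSection s hs).map (F.map m)) (F.compOfSectionIso s hs A).inv :=
  IsPullback.of_horiz_isIso ⟨(F.compOfSectionIso_inv_naturality s hs m).symm⟩

/-- The comparison of the composite of a fully faithful inclusion functor and a section with the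
identity. -/
noncomputable def compOfSectionNat :
    InclusionNatTrans (F.comp (F.ofSection hincl hmax s hs)) (BoundedInclusionFunctor.id C) where
  app A := (F.compOfSectionIso s hs A).hom
  naturality f := F.compOfSectionIso_hom_naturality s hs f

/-- The inverse of `compOfSectionNat`. -/
noncomputable def compOfSectionNatInv :
    InclusionNatTrans (BoundedInclusionFunctor.id C) (F.comp (F.ofSection hincl hmax s hs)) where
  app A := (F.compOfSectionIso s hs A).inv
  naturality f := F.compOfSectionIso_inv_naturality s hs f

/-- The comparison of the composite of a fully faithful inclusion functor and a section with the
identity, as a total natural transformation. -/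
noncomputable def compOfSectionTotalNat : TotalInclusionNatTrans
    (F.comp (F.ofSection hincl hmax s hs)) (BoundedInclusionFunctor.id C) where
  app A := (F.compOfSectionIso s hs A).hom
  naturality f := F.compOfSectionIso_hom_naturality s hs f
  isPullback m _ := F.isPullback_compOfSectionIso_hom s hs m

/-- The inverse of `compOfSectionTotalNat`. -/
noncomputable def compOfSectionTotalNatInv : TotalInclusionNatTrans
    (BoundedInclusionFunctor.id C) (F.comp (F.ofSection hincl hmax s hs)) where
  app A := (F.compOfSectionIso s hs A).inv
  naturality f := F.compOfSectionIso_inv_naturality s hs f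
  isPullback m _ := F.isPullback_compOfSectionIso_inv s hs m

end BoundedInclusionFunctor

/-- The inverse of the comparison functor of a restriction category. -/
noncomputable def RestIdem.unitInverse (X : RestrictionCategory.{u}) :
    RestrictionFunctor (boundedInclusionCategory X).partialMaps X :=
  (unitFunctor X).ofSection _ unitFunctor_obj_base

theorem RestIdem.unitFunctor_comp_unitInverse (X : RestrictionCategory.{u}) :
    (unitFunctor X).comp (unitInverse X) = RestrictionFunctor.id X :=
  RestrictionFunctor.comp_ofSection _ _ _ unitFunctor_obj_injective

theorem RestIdem.unitInverse_comp_unitFunctor (X : RestrictionCategory.{u}) :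
    (unitInverse X).comp (unitFunctor X) = RestrictionFunctor.id _ :=
  RestrictionFunctor.ofSection_comp _ _ _

namespace BoundedInclusionCategory

variable {C : BoundedInclusionCategory.{u}} (hC : C.IsCancellative)

/-- A section of the comparison functor of a bounded inclusion category. -/
noncomputable def counitSection :
    BoundedInclusionFunctor (RestIdem.boundedInclusionCategory C.partialMaps) C :=
  C.counit.ofSection (incl_of_incl_counit_map hC) (isMaximalInclusion_of_counit_map hC) _
    (Function.surjInv_eq counitFunctor_obj_surjective)

theorem counitSection_comp_counit :
    (counitSection hC).comp C.counit = BoundedInclusionFunctor.id _ :=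
  BoundedInclusionFunctor.ofSection_comp _ _ _ _ _

theorem counit_comp_counitSection (hC' : C.IsSkeletal) :
    C.counit.comp (counitSection hC) = BoundedInclusionFunctor.id C :=
  BoundedInclusionFunctor.comp_ofSection _ _ _ _ _ (counitFunctor_obj_injective hC')

/-- The comparison of `C.counit.comp (counitSection hC)` with the identity. -/
noncomputable def counitNat :
    InclusionNatTrans (C.counit.comp (counitSection hC)) (BoundedInclusionFunctor.id C) :=
  C.counit.compOfSectionNat _ _ _ _

/-- The inverse of `counitNat`. -/
noncomputable def counitNatInv :
    InclusionNatTrans (BoundedInclusionFunctor.id C) (C.counit.comp (counitSection hC)) :=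
  C.counit.compOfSectionNatInv _ _ _ _

/-- The comparison of `C.counit.comp (counitSection hC)` with the identity, as a total natural
transformation. -/
noncomputable def counitTotalNat :
    TotalInclusionNatTrans (C.counit.comp (counitSection hC)) (BoundedInclusionFunctor.id C) :=
  C.counit.compOfSectionTotalNat _ _ _ _

/-- The inverse of `counitTotalNat`. -/
noncomputable def counitTotalNatInv :
    TotalInclusionNatTrans (BoundedInclusionFunctor.id C) (C.counit.comp (counitSection hC)) :=
  C.counit.compOfSectionTotalNatInv _ _ _ _

end BoundedInclusionCategory

/-! ### The strict 2-functors and the two 2-equivalences -/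

open Bicategory InducedBicategory

/-- Strict naturality of 1-cells holds as a propositional equality of functors, so the 2-cells
compared have different types. Substitution reduces the 2-dimensional identities to heterogeneous
equality of components. -/
theorem InvBNCatLax.comp_eqToHom {X Y : InvBNCatLax.{u}} {F F' G G' : X ⟶ Y} (hF : F = F')
    (hG : G = G') (α : F ⟶ G) (β : F' ⟶ G')
    (h : ∀ A : X.1.carrier, InclusionNatTrans.app α.hom A ≍ InclusionNatTrans.app β.hom A) :
    α ≫ eqToHom hG = eqToHom hF ≫ β := by
  subst hF hG
  rw [eqToHom_refl, eqToHom_refl, Category.comp_id, Category.id_comp]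
  exact Hom₂.ext (InclusionNatTrans.ext (funext fun A => eq_of_heq (h A)))

theorem InvBNCatLax.eq_eqToHom_comp {X Y : InvBNCatLax.{u}} {F F' G G' : X ⟶ Y} (hF : F = F')
    (hG : G = G') (α : F ⟶ G) (β : F' ⟶ G')
    (h : ∀ A : X.1.carrier, InclusionNatTrans.app α.hom A ≍ InclusionNatTrans.app β.hom A) :
    α = eqToHom hF ≫ β ≫ eqToHom hG.symm := by
  rw [← Category.assoc, ← comp_eqToHom_iff hG, comp_eqToHom hF hG α β h]

theorem InvRCat.comp_eqToHom {X Y : InvRCat.{u}} {F F' G G' : X ⟶ Y} (hF : F = F')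
    (hG : G = G') (α : F ⟶ G) (β : F' ⟶ G')
    (h : ∀ A : X.1.carrier, TotalRestrictionNatTrans.app α.hom A ≍ TotalRestrictionNatTrans.app β.hom A) :
    α ≫ eqToHom hG = eqToHom hF ≫ β := by
  subst hF hG
  rw [eqToHom_refl, eqToHom_refl, Category.comp_id, Category.id_comp]
  exact Hom₂.ext (TotalRestrictionNatTrans.ext (funext fun A => eq_of_heq (h A)))

theorem InvRCat.eq_eqToHom_comp {X Y : InvRCat.{u}} {F F' G G' : X ⟶ Y} (hF : F = F')
    (hG : G = G') (α : F ⟶ G) (β : F' ⟶ G')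
    (h : ∀ A : X.1.carrier, TotalRestrictionNatTrans.app α.hom A ≍ TotalRestrictionNatTrans.app β.hom A) :
    α = eqToHom hF ≫ β ≫ eqToHom hG.symm := by
  rw [← Category.assoc, ← comp_eqToHom_iff hG, comp_eqToHom hF hG α β h]

theorem InvRCatLax.comp_eqToHom {X Y : InvRCatLax.{u}} {F F' G G' : X ⟶ Y} (hF : F = F')
    (hG : G = G') (α : F ⟶ G) (β : F' ⟶ G')
    (h : ∀ A : X.1.carrier, RestrictionNatTrans.app α.hom A ≍ RestrictionNatTrans.app β.hom A) :
    α ≫ eqToHom hG = eqToHom hF ≫ β := by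
  subst hF hG
  rw [eqToHom_refl, eqToHom_refl, Category.comp_id, Category.id_comp]
  exact Hom₂.ext (RestrictionNatTrans.ext (funext fun A => eq_of_heq (h A)))

theorem InvRCatLax.eq_eqToHom_comp {X Y : InvRCatLax.{u}} {F F' G G' : X ⟶ Y} (hF : F = F')
    (hG : G = G') (α : F ⟶ G) (β : F' ⟶ G')
    (h : ∀ A : X.1.carrier, RestrictionNatTrans.app α.hom A ≍ RestrictionNatTrans.app β.hom A) :
    α = eqToHom hF ≫ β ≫ eqToHom hG.symm := by
  rw [← Category.assoc, ← comp_eqToHom_iff hG, comp_eqToHom hF hG α β h]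

theorem InvBNCat.comp_eqToHom {X Y : InvBNCat.{u}} {F F' G G' : X ⟶ Y} (hF : F = F')
    (hG : G = G') (α : F ⟶ G) (β : F' ⟶ G')
    (h : ∀ A : X.1.carrier, TotalInclusionNatTrans.app α.hom A ≍ TotalInclusionNatTrans.app β.hom A) :
    α ≫ eqToHom hG = eqToHom hF ≫ β := by
  subst hF hG
  rw [eqToHom_refl, eqToHom_refl, Category.comp_id, Category.id_comp]
  exact Hom₂.ext (TotalInclusionNatTrans.ext (funext fun A => eq_of_heq (h A)))

theorem InvBNCat.eq_eqToHom_comp {X Y : InvBNCat.{u}} {F F' G G' : X ⟶ Y} (hF : F = F')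
    (hG : G = G') (α : F ⟶ G) (β : F' ⟶ G')
    (h : ∀ A : X.1.carrier, TotalInclusionNatTrans.app α.hom A ≍ TotalInclusionNatTrans.app β.hom A) :
    α = eqToHom hF ≫ β ≫ eqToHom hG.symm := by
  rw [← Category.assoc, ← comp_eqToHom_iff hG, comp_eqToHom hF hG α β h]

/-- The 2-functor of restriction idempotents. -/
def InvRCatLax.restIdem : StrictPseudofunctor InvRCatLax.{u} InvBNCatLax.{u} :=
  StrictPseudofunctor.mk''
    { obj := fun X => ⟨RestIdem.boundedInclusionCategory X.1, RestIdem.isInverse X.2,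
        RestIdem.isCancellative⟩
      map := fun F => mkHom ⟨RestIdem.map F.hom.functor⟩
      map₂ := fun α => ⟨RestIdem.mapNat α.hom⟩
      map₂_id := fun _ => Hom₂.ext (InclusionNatTrans.ext (funext fun _ =>
        RestIdem.hom_ext (Category.comp_id _)))
      map₂_comp := fun α β => Hom₂.ext (RestIdem.mapNat_vcomp α.hom β.hom)
      map_id := fun _ => rfl
      map_comp := fun _ _ => rfl
      map₂_whisker_left := fun _ _ _ _ => InvBNCatLax.eq_eqToHom_comp rfl rfl _ _ fun _ => HEq.rfl
      map₂_whisker_right := fun α G => InvBNCatLax.eq_eqToHom_comp rfl rfl _ _ fun _ =>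
        heq_of_eq (RestIdem.mapNat_whiskerRight_app α.hom G.hom.functor _) }

/-- The 2-functor of restriction idempotents on total natural transformations. -/
def InvRCat.restIdem : StrictPseudofunctor InvRCat.{u} InvBNCat.{u} :=
  StrictPseudofunctor.mk''
    { obj := fun X => ⟨RestIdem.boundedInclusionCategory X.1, RestIdem.isInverse X.2,
        RestIdem.isCancellative⟩
      map := fun F => mkHom ⟨RestIdem.map F.hom.functor⟩
      map₂ := fun α => ⟨RestIdem.mapTotalNat α.hom⟩
      map₂_id := fun _ => Hom₂.ext (TotalInclusionNatTrans.ext (funext fun _ =>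
        RestIdem.hom_ext (Category.comp_id _)))
      map₂_comp := fun α β => Hom₂.ext (RestIdem.mapTotalNat_vcomp α.hom β.hom)
      map_id := fun _ => rfl
      map_comp := fun _ _ => rfl
      map₂_whisker_left := fun _ _ _ _ => InvBNCat.eq_eqToHom_comp rfl rfl _ _ fun _ => HEq.rfl
      map₂_whisker_right := fun α G => InvBNCat.eq_eqToHom_comp rfl rfl _ _ fun _ =>
        heq_of_eq (RestIdem.mapTotalNat_whiskerRight_app α.hom G.hom.functor _) }

/-- The inverse restriction category of partial morphisms between maximal objects. -/
noncomputable abbrev InvBNCatLax.partialMapsObj (C : InvBNCatLax.{u}) : InvRCatLax.{u} :=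
  ⟨C.1.partialMaps, BoundedInclusionCategory.partialMaps_isInverse C.2.1⟩

theorem InvBNCatLax.mapPartialMaps_comp {C D E : InvBNCatLax.{u}} (F : C ⟶ D) (G : D ⟶ E) :
    (mkHom ⟨(F ≫ G).hom.functor.mapPartialMaps⟩ : C.partialMapsObj ⟶ E.partialMapsObj) =
      (mkHom ⟨F.hom.functor.mapPartialMaps⟩ : C.partialMapsObj ⟶ D.partialMapsObj) ≫
        mkHom ⟨G.hom.functor.mapPartialMaps⟩ :=
  InducedBicategory.hom_ext (RCatLax.Hom.ext
    (F.hom.functor.mapPartialMaps_comp G.hom.functor))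

/-- The 2-functor of partial morphisms between maximal objects. -/
noncomputable def InvBNCatLax.partialMaps : StrictPseudofunctor InvBNCatLax.{u} InvRCatLax.{u} :=
  StrictPseudofunctor.mk''
    { obj := fun C => C.partialMapsObj
      map := fun F => mkHom ⟨F.hom.functor.mapPartialMaps⟩
      map₂ := fun α => ⟨InclusionNatTrans.mapPartialMaps α.hom⟩
      map₂_id := fun _ => rfl
      map₂_comp := fun _ _ => Hom₂.ext (RestrictionNatTrans.ext (funext fun _ =>
        (mk_comp_mk_of_factor _ (Category.comp_id _)).symm))
      map_id := fun _ => InducedBicategory.hom_ext (RCatLax.Hom.ext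
        (BoundedInclusionFunctor.mapPartialMaps_id _))
      map_comp := InvBNCatLax.mapPartialMaps_comp
      map₂_whisker_left := fun _ _ _ _ => InvRCatLax.eq_eqToHom_comp
        (InvBNCatLax.mapPartialMaps_comp _ _) (InvBNCatLax.mapPartialMaps_comp _ _) _ _ fun _ => HEq.rfl
      map₂_whisker_right := fun _ G => InvRCatLax.eq_eqToHom_comp
        (InvBNCatLax.mapPartialMaps_comp _ _) (InvBNCatLax.mapPartialMaps_comp _ _) _ _ fun _ =>
        heq_of_eq (mk_congr (G.hom.functor.map_id _).symm rfl) }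

/-- The 1-cell underlying the unit. -/
noncomputable def InvRCatLax.unit (X : InvRCatLax.{u}) :
    X ⟶ InvBNCatLax.partialMaps.obj (InvRCatLax.restIdem.obj X) :=
  mkHom ⟨RestIdem.unitFunctor X.1⟩

theorem InvRCatLax.unit_isIso (X : InvRCatLax.{u}) : IsIsoOneCell X.unit :=
  ⟨mkHom ⟨RestIdem.unitInverse X.1⟩,
    InducedBicategory.hom_ext (RCatLax.Hom.ext (RestIdem.unitFunctor_comp_unitInverse X.1)),
    InducedBicategory.hom_ext (RCatLax.Hom.ext (RestIdem.unitInverse_comp_unitFunctor X.1))⟩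

/-- The 1-cell underlying the counit. -/
noncomputable def InvBNCatLax.counit (C : InvBNCatLax.{u}) :
    C ⟶ InvRCatLax.restIdem.obj (InvBNCatLax.partialMaps.obj C) :=
  mkHom ⟨BoundedInclusionCategory.counit C.1⟩

/-- A section of the counit. -/
noncomputable def InvBNCatLax.counitSection (C : InvBNCatLax.{u}) :
    InvRCatLax.restIdem.obj (InvBNCatLax.partialMaps.obj C) ⟶ C :=
  mkHom ⟨BoundedInclusionCategory.counitSection C.2.2⟩

theorem InvBNCatLax.counitSection_comp (C : InvBNCatLax.{u}) :
    C.counitSection ≫ C.counit = 𝟙 _ :=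
  InducedBicategory.hom_ext (BNCatLax.Hom.ext
    (BoundedInclusionCategory.counitSection_comp_counit C.2.2))

/-- The counit followed by its section is isomorphic to the identity. -/
noncomputable def InvBNCatLax.counitIso (C : InvBNCatLax.{u}) :
    C.counit ≫ C.counitSection ≅ 𝟙 C where
  hom := ⟨BoundedInclusionCategory.counitNat C.2.2⟩
  inv := ⟨BoundedInclusionCategory.counitNatInv C.2.2⟩
  hom_inv_id := Hom₂.ext (InclusionNatTrans.ext (funext fun _ => Iso.hom_inv_id _))
  inv_hom_id := Hom₂.ext (InclusionNatTrans.ext (funext fun _ => Iso.inv_hom_id _))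

theorem InvBNCatLax.counit_isEquiv (C : InvBNCatLax.{u}) : IsEquivOneCell C.counit :=
  ⟨C.counitSection, ⟨C.counitIso⟩, ⟨eqToIso C.counitSection_comp⟩⟩

theorem InvBNCatLax.counit_isIso (C : InvBNCatLax.{u}) (hC : C.1.IsSkeletal) :
    IsIsoOneCell C.counit :=
  ⟨C.counitSection, InducedBicategory.hom_ext (BNCatLax.Hom.ext
    (BoundedInclusionCategory.counit_comp_counitSection C.2.2 hC)), C.counitSection_comp⟩

/-- The 2-equivalence of inverse restriction categories and inverse bounded inclusion categories. -/
noncomputable def InvRCatLax.twoEquivalence : TwoEquivalence InvRCatLax.{u} InvBNCatLax.{u} where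
  functor := InvRCatLax.restIdem
  inverse := InvBNCatLax.partialMaps
  unit :=
    { app := InvRCatLax.unit
      naturality := fun F => InducedBicategory.hom_ext (RCatLax.Hom.ext
        (RestIdem.unitFunctor_naturality F.hom.functor))
      naturality₂ := fun α => InvRCatLax.comp_eqToHom _ _ _ _ fun A =>
        RestIdem.unitFunctor_map_app α.hom A }
  counit :=
    { app := InvBNCatLax.counit
      naturality := fun F => InducedBicategory.hom_ext (BNCatLax.Hom.ext
        (BoundedInclusionCategory.counit_naturality F.hom.functor))
      naturality₂ := fun α => InvBNCatLax.comp_eqToHom _ _ _ _ fun A =>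
        BoundedInclusionCategory.counit_map_app α.hom A }
  unit_isEquiv := fun X => X.unit_isIso.isEquivOneCell
  counit_isEquiv := InvBNCatLax.counit_isEquiv

/-- The inverse restriction category of partial morphisms between maximal objects. -/
noncomputable abbrev InvBNCat.partialMapsObj (C : InvBNCat.{u}) : InvRCat.{u} :=
  ⟨C.1.partialMaps, BoundedInclusionCategory.partialMaps_isInverse C.2.1⟩

theorem InvBNCat.mapPartialMaps_comp {C D E : InvBNCat.{u}} (F : C ⟶ D) (G : D ⟶ E) :
    (mkHom ⟨(F ≫ G).hom.functor.mapPartialMaps⟩ : C.partialMapsObj ⟶ E.partialMapsObj) =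
      (mkHom ⟨F.hom.functor.mapPartialMaps⟩ : C.partialMapsObj ⟶ D.partialMapsObj) ≫
        mkHom ⟨G.hom.functor.mapPartialMaps⟩ :=
  InducedBicategory.hom_ext (RCat.Hom.ext
    (F.hom.functor.mapPartialMaps_comp G.hom.functor))

/-- The 2-functor of partial morphisms between maximal objects, on total natural
transformations. -/
noncomputable def InvBNCat.partialMaps : StrictPseudofunctor InvBNCat.{u} InvRCat.{u} :=
  StrictPseudofunctor.mk''
    { obj := fun C => C.partialMapsObj
      map := fun F => mkHom ⟨F.hom.functor.mapPartialMaps⟩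
      map₂ := fun α => ⟨TotalInclusionNatTrans.mapPartialMaps α.hom⟩
      map₂_id := fun _ => rfl
      map₂_comp := fun _ _ => Hom₂.ext (TotalRestrictionNatTrans.ext (funext fun _ =>
        (mk_comp_mk_of_factor _ (Category.comp_id _)).symm))
      map_id := fun _ => InducedBicategory.hom_ext (RCat.Hom.ext
        (BoundedInclusionFunctor.mapPartialMaps_id _))
      map_comp := InvBNCat.mapPartialMaps_comp
      map₂_whisker_left := fun _ _ _ _ => InvRCat.eq_eqToHom_comp
        (InvBNCat.mapPartialMaps_comp _ _) (InvBNCat.mapPartialMaps_comp _ _) _ _ fun _ => HEq.rfl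
      map₂_whisker_right := fun _ G => InvRCat.eq_eqToHom_comp
        (InvBNCat.mapPartialMaps_comp _ _) (InvBNCat.mapPartialMaps_comp _ _) _ _ fun _ =>
        heq_of_eq (mk_congr (G.hom.functor.map_id _).symm rfl) }

/-- The 1-cell underlying the unit. -/
noncomputable def InvRCat.unit (X : InvRCat.{u}) :
    X ⟶ InvBNCat.partialMaps.obj (InvRCat.restIdem.obj X) :=
  mkHom ⟨RestIdem.unitFunctor X.1⟩

theorem InvRCat.unit_isIso (X : InvRCat.{u}) : IsIsoOneCell X.unit :=
  ⟨mkHom ⟨RestIdem.unitInverse X.1⟩,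
    InducedBicategory.hom_ext (RCat.Hom.ext (RestIdem.unitFunctor_comp_unitInverse X.1)),
    InducedBicategory.hom_ext (RCat.Hom.ext (RestIdem.unitInverse_comp_unitFunctor X.1))⟩

/-- The 1-cell underlying the counit. -/
noncomputable def InvBNCat.counit (C : InvBNCat.{u}) :
    C ⟶ InvRCat.restIdem.obj (InvBNCat.partialMaps.obj C) :=
  mkHom ⟨BoundedInclusionCategory.counit C.1⟩

/-- A section of the counit. -/
noncomputable def InvBNCat.counitSection (C : InvBNCat.{u}) :
    InvRCat.restIdem.obj (InvBNCat.partialMaps.obj C) ⟶ C :=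
  mkHom ⟨BoundedInclusionCategory.counitSection C.2.2⟩

theorem InvBNCat.counitSection_comp (C : InvBNCat.{u}) :
    C.counitSection ≫ C.counit = 𝟙 _ :=
  InducedBicategory.hom_ext (BNCat.Hom.ext
    (BoundedInclusionCategory.counitSection_comp_counit C.2.2))

/-- The counit followed by its section is isomorphic to the identity. -/
noncomputable def InvBNCat.counitIso (C : InvBNCat.{u}) :
    C.counit ≫ C.counitSection ≅ 𝟙 C where
  hom := ⟨BoundedInclusionCategory.counitTotalNat C.2.2⟩
  inv := ⟨BoundedInclusionCategory.counitTotalNatInv C.2.2⟩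
  hom_inv_id := Hom₂.ext (TotalInclusionNatTrans.ext (funext fun _ => Iso.hom_inv_id _))
  inv_hom_id := Hom₂.ext (TotalInclusionNatTrans.ext (funext fun _ => Iso.inv_hom_id _))

theorem InvBNCat.counit_isEquiv (C : InvBNCat.{u}) : IsEquivOneCell C.counit :=
  ⟨C.counitSection, ⟨C.counitIso⟩, ⟨eqToIso C.counitSection_comp⟩⟩

theorem InvBNCat.counit_isIso (C : InvBNCat.{u}) (hC : C.1.IsSkeletal) :
    IsIsoOneCell C.counit :=
  ⟨C.counitSection, InducedBicategory.hom_ext (BNCat.Hom.ext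
    (BoundedInclusionCategory.counit_comp_counitSection C.2.2 hC)), C.counitSection_comp⟩

/-- The 2-equivalence of inverse restriction categories and inverse bounded inclusion categories,
with total natural transformations as 2-cells. -/
noncomputable def InvRCat.twoEquivalence : TwoEquivalence InvRCat.{u} InvBNCat.{u} where
  functor := InvRCat.restIdem
  inverse := InvBNCat.partialMaps
  unit :=
    { app := InvRCat.unit
      naturality := fun F => InducedBicategory.hom_ext (RCat.Hom.ext
        (RestIdem.unitFunctor_naturality F.hom.functor))
      naturality₂ := fun α => InvRCat.comp_eqToHom _ _ _ _ fun A =>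
        RestIdem.unitFunctor_map_total_app α.hom A }
  counit :=
    { app := InvBNCat.counit
      naturality := fun F => InducedBicategory.hom_ext (BNCat.Hom.ext
        (BoundedInclusionCategory.counit_naturality F.hom.functor))
      naturality₂ := fun α => InvBNCat.comp_eqToHom _ _ _ _ fun A =>
        BoundedInclusionCategory.counit_map_total_app α.hom A }
  unit_isEquiv := fun X => X.unit_isIso.isEquivOneCell
  counit_isEquiv := InvBNCat.counit_isEquiv

/-- Since N takes values in skeletal objects, both comparisons have invertible components over the
skeletal objects; this contains the restricted strict 2-equivalences. -/
theorem mainTheorem11 :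
    (∃ e : TwoEquivalence InvRCatLax.{u} InvBNCatLax.{u},
      (∀ X : InvRCatLax.{u}, IsIsoOneCell (e.unit.app X)) ∧
      (∀ X : InvRCatLax.{u}, (e.functor.obj X).1.IsSkeletal) ∧
      (∀ C : InvBNCatLax.{u}, C.1.IsSkeletal → IsIsoOneCell (e.counit.app C))) ∧
    (∃ e : TwoEquivalence InvRCat.{u} InvBNCat.{u},
      (∀ X : InvRCat.{u}, IsIsoOneCell (e.unit.app X)) ∧
      (∀ X : InvRCat.{u}, (e.functor.obj X).1.IsSkeletal) ∧
      (∀ C : InvBNCat.{u}, C.1.IsSkeletal → IsIsoOneCell (e.counit.app C))) :=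
  ⟨⟨InvRCatLax.twoEquivalence, InvRCatLax.unit_isIso, fun _ => RestIdem.isSkeletal,
      InvBNCatLax.counit_isIso⟩,
    ⟨InvRCat.twoEquivalence, InvRCat.unit_isIso, fun _ => RestIdem.isSkeletal,
      InvBNCat.counit_isIso⟩⟩
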